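/- Let $G=(V,E)$ be a finite simple graph with sets $I,O\subseteq V$ of inputs and outputs; $W^c$ denotes the complement $V\setminus W$ of $W\subseteq V$. Let $(f,\preceq)$ be a flow for $(G,I,O)$: $\preceq$ is a partial order on $V$ and $f:O^c\to I^c$ satisfies, for all $x\in O^c$, $x\sim f(x)$; $x\preceq f(x)$; and $x\preceq y$ for every $y\ne x$ with $y\sim f(x)$. Suppose that $|I|=|O|$ or that $f$ is surjective (so $f$ is a bijection), and let $a=(a_i)_{i\in O^c}$ be real angles. Commands on qubits: $N_i$ prepares qubit $i$ in a given state; $E_{i,j}$ is controlled-$Z$; $M_i^\alpha$ measures $i$ in the basis $|\pm_\alpha\rangle=(|0\rangle\pm e^{i\alpha}|1\rangle)/\sqrt2$, with outcome $s_i\in\{0,1\}$, and removes it; ${}^{t}[M_i^\alpha]^{s}=M_i^{(-1)^s\alpha+t\pi}$; $X_i^s,Z_i^s$ are Pauli corrections; signals $s,t$ are sums mod 2 of outcomes. A command sequence is runnable if (R0) no command depends on an outcome not yet measured, (R1) no command except preparation acts on a measured or not yet prepared qubit (inputs count as prepared), and (R2) a qubit is measured iff it is not an output, and prepared iff it is not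 an input. A pattern on $(G,I,O)$ with flow $(f,\preceq)$ and angles $a$ is a command sequence in which each $i\in I^c$ is prepared once, in $|+\rangle$; each edge of $G$ is entangled once; each $i\in O^c$ is measured once, with angle $a_i$; there are no other preparations, entangling commands or measurements; no entangling command follows a Pauli correction on one of its qubits; and the outcome $s_j$ of each $j\in O^c$ induces in total (mod 2, through Pauli corrections or adaptive measurements) exactly an $X$-correction on $f(j)$ and a $Z$-correction on every $k\sim f(j)$, $k\ne j$. For example, this holds for $\prod^{\preceq}_{j\in O^c}\big(X_{f(j)}^{s_j}\prod_{k\sim f(j),\,k\ne j}Z_k^{s_j}\,M_j^{a_j}\big)E_GN_{I^c}$, where $N_{I^c}$ prepares every qubit of $I^c$ in $|+\rangle$ and $E_G=\prod_{\{i,j\}\in E}E_{i,j}$. Fix any enumeration of $O^c$ compatible with $\preceq$. For a neighbour $k$ of $i\in O^c$ write $k>i$ if $k\in O$ or $k$ is enumerated after $i$. Put $S_i^x=s_{f^{-1}(i)}$ for $i\in I^c$, $S_i^x=0$ for $i\in I$, and $S_i^z=\sum_{k\in I^c,\,k\sim i,\,i\ne f^{-1}(k)}s_{f^{-1}(k)}\bmod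 2$. Let $$P_a=\prod_{i\in O}X_i^{S_i^x}Z_i^{S_i^z}\ \prod_{\{i,k\}\in E,\ i,k\in O}E_{i,k}\ \prod_{i\in O^c}\Big({}^{S_i^z}[M_i^{a_i}]^{S_i^x}\Big(\prod_{k\sim i,\,k>i}E_{i,k}\Big)N_{f(i)}(|+\rangle)\Big),$$ where commands are executed from right to left and the last product follows the enumeration, so that earlier $i$ stand further right. Then: 1. $P_a$ is runnable, and it is itself a pattern on $(G,I,O)$ with flow $(f,\preceq)$ and angles $a$. 2. Every runnable pattern $P$ on $(G,I,O)$ with flow $(f,\preceq)$ and angles $a$ can be rewritten as $P_a$: for each tuple of measurement outcomes the operators of $P$ and $P_a$ from inputs to outputs agree up to a global phase. 3. The operator $U=2^{|O^c|/2}\big(\prod_{i\in O^c}\langle+_{a_i}|_i\big)E_GN_{I^c}$ from the input space to the output space is unitary, and $P_a$ implements it: for every tuple of outcomes the operator of $P_a$ is $2^{-|O^c|/2}U$ up to a global phase, so that $P_a$ realises the channel $\rho\mapsto U\rho U^\dagger$. -/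

import Mathlib

open scoped Matrix ComplexConjugate

noncomputable section

namespace MBQC

/-! ### Patterns: commands, runnability -/

/-- The elementary commands of a measurement pattern on the qubits `V`. A signal is a sum modulo 2
of measurement outcomes and is given by the set of the qubits whose outcomes are summed.
* `prep v q` is `N_v(|q⟩)`: prepare qubit `v` in the state `|q⟩ = q 0 |0⟩ + q 1 |1⟩`;
* `ent s(v, w)` is `E_{v,w}`: apply controlled-`Z` to the qubits `v ≠ w`;
* `meas v α S T` is the adaptive measurement of `v` with angle `(-1)^{s_S} α + s_T π`, where `s_S`
  and `s_T` are the signals of `S` and `T`; `meas v α ∅ ∅` is the plain measurement `M_v^α`;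
* `corrX v S` and `corrZ v S` are the Pauli corrections `X_v^{s_S}` and `Z_v^{s_S}`. -/
inductive Command (V : Type*) where
  | prep (v : V) (q : ZMod 2 → ℂ) : Command V
  | ent (e : Sym2 V) : Command V
  | meas (v : V) (α : ℝ) (S T : Finset V) : Command V
  | corrX (v : V) (S : Finset V) : Command V
  | corrZ (v : V) (S : Finset V) : Command V

namespace Command

variable {V : Type*}

/-- The command acts on the qubit `w`. -/
def ActsOn (w : V) : Command V → Prop
  | prep v _ => w = v
  | ent e => w ∈ e
  | meas v _ _ _ => w = v
  | corrX v _ => w = v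
  | corrZ v _ => w = v

/-- The command depends on the outcome of the measurement of `w`. -/
def DependsOn (w : V) : Command V → Prop
  | prep _ _ => False
  | ent _ => False
  | meas _ _ S T => w ∈ S ∨ w ∈ T
  | corrX _ S => w ∈ S
  | corrZ _ S => w ∈ S

/-- The command prepares the qubit `w`. -/
def Prepares (w : V) : Command V → Prop
  | prep v _ => w = v
  | _ => False

/-- The command measures the qubit `w`. -/
def Measures (w : V) : Command V → Prop
  | meas v _ _ _ => w = v
  | _ => False

/-- The command is a Pauli correction on the qubit `w`. -/
def Corrects (w : V) : Command V → Prop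
  | corrX v _ => w = v
  | corrZ v _ => w = v
  | _ => False

/-- The qubit and the state of a preparation command. -/
def prepData : Command V → Option (V × (ZMod 2 → ℂ))
  | prep v q => some (v, q)
  | _ => none

/-- The pair of qubits of an entangling command. -/
def entData : Command V → Option (Sym2 V)
  | ent e => some e
  | _ => none

/-- The qubit and the (unadapted) angle of a measurement command. -/
def measData : Command V → Option (V × ℝ)
  | meas v α _ _ => some (v, α)
  | _ => none

open Classical in
/-- `1` if the command contains an `X`-correction of the qubit `w` by the outcome of `j`, either as
a Pauli correction or as a part of an adaptive measurement, and `0` otherwise. -/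
def xDep (w j : V) : Command V → ZMod 2
  | meas v _ S _ => if w = v ∧ j ∈ S then 1 else 0
  | corrX v S => if w = v ∧ j ∈ S then 1 else 0
  | _ => 0

open Classical in
/-- `1` if the command contains a `Z`-correction of the qubit `w` by the outcome of `j`, either as
a Pauli correction or as a part of an adaptive measurement, and `0` otherwise. -/
def zDep (w j : V) : Command V → ZMod 2
  | meas v _ _ T => if w = v ∧ j ∈ T then 1 else 0
  | corrZ v S => if w = v ∧ j ∈ S then 1 else 0
  | _ => 0

end Command

open Command

/-- A command sequence (in order of execution, the first command being the head of the list) with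
inputs `I` and outputs `O` is runnable. -/
structure Runnable {V : Type*} (I O : Finset V) (P : List (Command V)) : Prop where
  /-- (R0) no command depends on an outcome not yet measured -/
  depends : ∀ before c after, P = before ++ c :: after →
    ∀ j, c.DependsOn j → ∃ d ∈ before, d.Measures j
  /-- (R1) no command (except the preparation) acts on a measured or not yet prepared qubit -/
  acts : ∀ before c after, P = before ++ c :: after →
    ∀ v, c.ActsOn v → ¬ c.Prepares v →
      (¬ ∃ d ∈ before, d.Measures v) ∧ (v ∈ I ∨ ∃ d ∈ before, d.Prepares v)
  /-- (R2) a qubit is measured if and only if it is not an output -/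
  measured_iff : ∀ v, (∃ c ∈ P, c.Measures v) ↔ v ∉ O
  /-- (R2) a qubit is prepared if and only if it is not an input -/
  prepared_iff : ∀ v, (∃ c ∈ P, c.Prepares v) ↔ v ∉ I

/-! ### The quantum operation of a pattern -/

/-- The state `|+_α⟩ = (|0⟩ + e^{iα} |1⟩) / √2` (for `m = 0`) or
`|-_α⟩ = (|0⟩ - e^{iα} |1⟩) / √2` (for `m = 1`). -/
def ket (α : ℝ) (m : ZMod 2) (b : ZMod 2) : ℂ :=
  (if b = 0 then 1 else (-1) ^ m.val * Complex.exp (α * Complex.I)) / (Real.sqrt 2 : ℂ)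

/-- The state `|+⟩ = (|0⟩ + |1⟩) / √2`. -/
def plus : ZMod 2 → ℂ := ket 0 0

/-- The diagonal entry of controlled-`Z` on the pair `e` at the basis vector `|x⟩`. -/
def czSign {V : Type*} (e : Sym2 V) (x : V → ZMod 2) : ℂ :=
  open Classical in if ∀ v ∈ e, x v = 1 then -1 else 1

/-- The value of the signal of `S` when the outcomes are `s`. -/
def signal {V : Type*} (s : V → ZMod 2) (S : Finset V) : ZMod 2 := ∑ j ∈ S, s j

section Semantics

variable {V : Type*} [DecidableEq V]

/-- The action of a command on amplitudes, in the branch with outcomes `s`. A (pure, not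
normalized) state of the present qubits `W ⊆ V`, a vector in the tensor product over `W` of `ℂ²`,
is represented by its amplitudes, as a function of `x : V → ZMod 2` that depends on the coordinates
in `W` only. Preparation takes the tensor product with `|q⟩`; measurement with outcome `s v` applies
the bra of the corresponding basis vector to qubit `v`, which is thereby removed. -/
def Command.act (s : V → ZMod 2) : Command V → ((V → ZMod 2) → ℂ) → ((V → ZMod 2) → ℂ)
  | prep v q, ψ => fun x => q (x v) * ψ x
  | ent e, ψ => fun x => czSign e x * ψ x
  | meas v α S T, ψ => fun x =>
      ∑ b : ZMod 2,
        conj (ket ((-1) ^ (signal s S).val * α + (signal s T).val * Real.pi) (s v) b) *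
          ψ (Function.update x v b)
  | corrX v S, ψ => fun x => ψ (Function.update x v (x v + signal s S))
  | corrZ v S, ψ => fun x => (-1) ^ (x v * signal s S).val * ψ x

/-- The action of a command sequence in the branch with outcomes `s`. -/
def run (s : V → ZMod 2) (P : List (Command V)) (ψ : (V → ZMod 2) → ℂ) : (V → ZMod 2) → ℂ :=
  P.foldl (fun φ c => c.act s φ) ψ

/-- Extension by zero. -/
def extendZero (W : V → Prop) [DecidablePred W] (y : {v // W v} → ZMod 2) : V → ZMod 2 :=
  fun v => if h : W v then y ⟨v, h⟩ else 0

/-- The branch (Kraus) operator of the pattern `P` with inputs `I` and outputs `O` for the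
measurement outcomes `s`, as a matrix in the computational bases: column `x` is the output state
obtained from the input `|x⟩`. -/
def branch (I O : Finset V) (P : List (Command V)) (s : {v // v ∉ O} → ZMod 2) :
    Matrix ({v // v ∈ O} → ZMod 2) ({v // v ∈ I} → ZMod 2) ℂ :=
  Matrix.of fun y x =>
    run (extendZero (fun v => v ∉ O) s) P (fun z => if (fun v : {v // v ∈ I} => z v) = x then 1 else 0)
      (extendZero (fun v => v ∈ O) y)

/-- Two patterns with the same inputs and outputs perform the same computation: in every branch
their operators agree up to a global phase. -/
def Equivalent (I O : Finset V) (P Q : List (Command V)) : Prop :=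
  ∀ s : {v // v ∉ O} → ZMod 2, ∃ c : ℂ, ‖c‖ = 1 ∧ branch I O P s = c • branch I O Q s

/-- The pattern `P` implements `U` (strongly deterministically): all branches are equally likely,
each of them applies `U` up to a global phase, and the quantum channel of `P` is
`ρ ↦ U ρ U†`. -/
structure Implements [Fintype V] (I O : Finset V) (P : List (Command V))
    (U : Matrix ({v // v ∈ O} → ZMod 2) ({v // v ∈ I} → ZMod 2) ℂ) : Prop where
  branch_eq : ∀ s : {v // v ∉ O} → ZMod 2, ∃ c : ℂ, ‖c‖ = 1 ∧
    branch I O P s = (c / (Real.sqrt 2 : ℂ) ^ (Oᶜ).card) • U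
  channel_eq : ∀ ρ : Matrix ({v // v ∈ I} → ZMod 2) ({v // v ∈ I} → ZMod 2) ℂ,
    ∑ s : {v // v ∉ O} → ZMod 2, branch I O P s * ρ * (branch I O P s)ᴴ = U * ρ * Uᴴ

end Semantics

section Graphs

variable {V : Type*} [Fintype V] [DecidableEq V]

/-- The global preparation `N_{I^c}` of all non-input qubits in the state `|+⟩`. -/
def globalPrep (I : Finset V) : Matrix (V → ZMod 2) ({v // v ∈ I} → ZMod 2) ℂ :=
  Matrix.of fun z x => if (fun v : {v // v ∈ I} => z v) = x then ∏ v ∈ Iᶜ, plus (z v) else 0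

/-- The global entangling operator `E_G`. -/
def globalEnt (G : SimpleGraph V) [DecidableRel G.Adj] : Matrix (V → ZMod 2) (V → ZMod 2) ℂ :=
  Matrix.diagonal fun z => ∏ e ∈ G.edgeFinset, czSign e z

/-- The product of the bras `⟨+_{a_i}|_i` over all non-output qubits `i`. -/
def plusBras (O : Finset V) (a : {v // v ∉ O} → ℝ) :
    Matrix ({v // v ∈ O} → ZMod 2) (V → ZMod 2) ℂ :=
  Matrix.of fun y z => if (fun v : {v // v ∈ O} => z v) = y then
    ∏ i : {v // v ∉ O}, conj (ket (a i) 0 (z i)) else 0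

/-- `U_{G,I,O,a} = 2^{|O^c|/2} (∏_{i ∈ O^c} ⟨+_{a_i}|_i) E_G N_{I^c}`. -/
def flowUnitary (G : SimpleGraph V) [DecidableRel G.Adj] (I O : Finset V)
    (a : {v // v ∉ O} → ℝ) : Matrix ({v // v ∈ O} → ZMod 2) ({v // v ∈ I} → ZMod 2) ℂ :=
  (Real.sqrt 2 : ℂ) ^ (Oᶜ).card • (plusBras O a * globalEnt G * globalPrep I)

/-- `(f, ≤)` is a flow for the geometry `(G, I, O)`. -/
structure IsFlow [PartialOrder V] (G : SimpleGraph V) (I O : Finset V)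
    (f : {v // v ∉ O} → {v // v ∉ I}) : Prop where
  adj : ∀ x : {v // v ∉ O}, G.Adj x (f x)
  le : ∀ x : {v // v ∉ O}, (x : V) ≤ f x
  le_of_adj : ∀ (x : {v // v ∉ O}) (y : V), y ≠ x → G.Adj y (f x) → (x : V) ≤ y

open Classical in
/-- `P` is a measurement pattern on the open graph state `(G, I, O)` with the measurement angles
`a` and the dependencies of the flow function `f`:
* every non-input qubit is prepared, once, in the state `|+⟩`, and there are no other preparations;
* there is one entangling command for every edge of `G`, and no other;
* every non-output qubit `i` is measured, once, with angle `a i`, and no other qubit is;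
* no entangling command comes after a correction on one of its qubits;
* in total (modulo 2) the outcome of `j` induces exactly the `X`-correction on `f j` and the
  `Z`-corrections on the neighbours of `f j` other than `j`.

In particular, this includes every linearization of
`∏_{j ∈ O^c} (X_{f j}^{s_j} ∏_{k ∼ f j, k ≠ j} Z_k^{s_j} M_j^{a_j}) E_G N_{I^c}`. -/
structure IsFlowPattern (G : SimpleGraph V) [DecidableRel G.Adj] (I O : Finset V)
    (f : {v // v ∉ O} → {v // v ∉ I}) (a : {v // v ∉ O} → ℝ) (P : List (Command V)) : Prop where
  preps : (P.filterMap prepData : Multiset (V × (ZMod 2 → ℂ))) =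
    (Iᶜ).val.map fun v => (v, plus)
  ents : (P.filterMap entData : Multiset (Sym2 V)) = G.edgeFinset.val
  meass : (P.filterMap measData : Multiset (V × ℝ)) =
    (Finset.univ : Finset {v // v ∉ O}).val.map fun i : {v // v ∉ O} => ((i : V), a i)
  ent_before : P.Pairwise fun c d => ∀ v e, c.Corrects v → d = ent e → v ∉ e
  xDeps : ∀ w j, (P.map (xDep w j)).sum = if ∃ h : j ∉ O, (f ⟨j, h⟩ : V) = w then 1 else 0
  zDeps : ∀ w j, (P.map (zDep w j)).sum =
    if ∃ h : j ∉ O, G.Adj (f ⟨j, h⟩) w ∧ w ≠ j then 1 else 0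

/-- `l` lists all non-output qubits, without repetition, in an order compatible with `≤`. -/
def IsMeasurementOrder [PartialOrder V] (O : Finset V) (l : List {v // v ∉ O}) : Prop :=
  (∀ i, i ∈ l) ∧ l.Pairwise fun i j : {v // v ∉ O} => ¬ (j : V) ≤ (i : V)

/-- Every partial order has a compatible measurement order. -/
theorem exists_isMeasurementOrder [PartialOrder V] (O : Finset V) :
    ∃ l : List {v // v ∉ O}, IsMeasurementOrder O l := by
  classical
  let e : {v // v ∉ O} → LinearExtension V := fun i => toLinearExtension (i : V)
  let r : {v // v ∉ O} → {v // v ∉ O} → Prop := fun i j => e i ≤ e j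
  have htot : ∀ i j, r i j ∨ r j i := fun i j => le_total (e i) (e j)
  have htr : ∀ i j k, r i j → r j k → r i k := fun i j k => le_trans
  let l := (Finset.univ : Finset {v // v ∉ O}).toList.mergeSort (fun i j => decide (r i j))
  have hp : l.Perm (Finset.univ : Finset {v // v ∉ O}).toList := List.mergeSort_perm _ _
  have hn : l.Nodup := hp.nodup_iff.mpr (Finset.nodup_toList _)
  have hs : l.Pairwise (fun i j => decide (r i j) = true) :=
    List.pairwise_mergeSort (fun a b c => by simpa using htr a b c)
      (fun a b => by simpa using htot a b) _
  refine ⟨l, fun i => hp.mem_iff.mpr (by simp), ?_⟩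
  refine (hs.and hn).imp ?_
  rintro i j ⟨h, hne⟩ hji
  have h1 : e i ≤ e j := by simpa [r] using h
  have h2 : e j ≤ e i := toLinearExtension.monotone hji
  have h3 : e i = e j := le_antisymm h1 h2
  exact hne (Subtype.ext h3)

open Classical in
/-- The signal `S_i^x`: it is `s_{f⁻¹(i)}` if `i ∈ I^c` and `0` otherwise. -/
def xSignal (I O : Finset V) (f : {v // v ∉ O} → {v // v ∉ I}) (i : V) : Finset V :=
  Finset.univ.filter fun j => ∃ h : j ∉ O, (f ⟨j, h⟩ : V) = i

open Classical in
/-- The signal `S_i^z`: the sum of `s_{f⁻¹(k)}` over all `k ∈ I^c` with `k ∼ i` and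
`i ≠ f⁻¹(k)`. -/
def zSignal (G : SimpleGraph V) (I O : Finset V) (f : {v // v ∉ O} → {v // v ∉ I}) (i : V) :
    Finset V :=
  Finset.univ.filter fun j => ∃ (h : j ∉ O) (k : {v // v ∉ I}), f ⟨j, h⟩ = k ∧ G.Adj k i ∧ i ≠ j

open Classical in
/-- The neighbours of `i` that come later than `i`: those that are outputs or are measured after
`i` in the order `l`. -/
def laterNeighbours (G : SimpleGraph V) (O : Finset V) (l : List {v // v ∉ O})
    (i : {v // v ∉ O}) : Finset V :=
  Finset.univ.filter fun k => G.Adj i k ∧ ∀ hk : k ∉ O, l.idxOf i < l.idxOf ⟨k, hk⟩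

/-- Step `i`: prepare `f i` in `|+⟩`, entangle `i` with its later neighbours, measure `i`
adaptively. -/
def compactStep (G : SimpleGraph V) (I O : Finset V) (f : {v // v ∉ O} → {v // v ∉ I})
    (a : {v // v ∉ O} → ℝ) (l : List {v // v ∉ O}) (i : {v // v ∉ O}) : List (Command V) :=
  prep (f i : V) plus ::
    ((laterNeighbours G O l i).toList.map (fun k => ent s((i : V), k)) ++
      [meas (i : V) (a i) (xSignal I O f i) (zSignal G I O f i)])

open Classical in
/-- The interleaved pattern `P_a`: the steps of the non-output qubits in the order `l`, then the
entangling commands of the edges joining two outputs, then the corrections of the outputs. -/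
def compactPattern (G : SimpleGraph V) [DecidableRel G.Adj] (I O : Finset V)
    (f : {v // v ∉ O} → {v // v ∉ I}) (a : {v // v ∉ O} → ℝ) (l : List {v // v ∉ O}) :
    List (Command V) :=
  l.flatMap (compactStep G I O f a l) ++
    ((G.edgeFinset.filter fun e => ∀ v ∈ e, v ∈ O).toList.map ent ++
      O.toList.flatMap fun i => [corrZ i (zSignal G I O f i), corrX i (xSignal I O f i)])

end Graphs

end MBQC

end

open scoped Matrix ComplexConjugate

namespace MBQC

open Command

/-! In the computational basis a branch operator is a sum over paths `z : V → ZMod 2`, where `z v`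
is the value of qubit `v` before any `X`-correction. An `X`-correction only shifts the relation
between the path and the current basis vector; every other command multiplies each path by a scalar,
up to a global phase. Entangling precedes corrections, so controlled-`Z` sees `z` itself; nothing
acts on a measured qubit, so its measurement already sees the total shift `X`. The weights are
therefore scalars independent of the order of the commands (`run_eq_pathSum`, `prod_map_weight`).

Now replace `z` by `z + X`. The exponent of `graphSign` is a quadratic form whose polar form is the
adjacency matrix (`graphSign_add`), which yields the cross term `∑ u, z u * ∑ v ∼ u, X v`. For the
dependencies of a flow the inner sum is the `Z`-correction of `u` plus the outcome of `u`
(`sum_xShift_neighbors`), so the cross term cancels all `Z`-corrections and all outcome signs. What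
remains is a phase times the path sum of `U` (`exists_branch_eq`). Thus all branches of all runnable
flow patterns are proportional to `U`, which gives both the equivalence and the channel.

For unitarity, `Uᴴ * U` is a sum over pairs of paths `z`, `z + d`. If `d ≠ 0` and `i` is maximal
with `d i ≠ 0`, flipping `z` at `f i` negates the summand (`sum_path_pair_eq_zero`), so only `d = 0`
survives; equal numbers of inputs and outputs make the isometry unitary. The interleaved pattern is
runnable because the flow places `j` before `f j` and before the other neighbours of `f j`. -/

/-! ### Signs -/

/-- The sign `(-1)^t` of `t : ZMod 2`. -/
def sgn (t : ZMod 2) : ℂ := (-1) ^ t.val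

@[simp] lemma sgn_zero : sgn 0 = 1 := by simp [sgn]

@[simp] lemma sgn_one : sgn 1 = -1 := by simp [sgn, ZMod.val_one]

lemma zmod_two_cases (t : ZMod 2) : t = 0 ∨ t = 1 := by
  revert t; decide

lemma sgn_add (a b : ZMod 2) : sgn (a + b) = sgn a * sgn b := by
  have h : (1 : ZMod 2) + 1 = 0 := by decide
  rcases zmod_two_cases a with rfl | rfl <;> rcases zmod_two_cases b with rfl | rfl <;> simp [h]

lemma sgn_mul_self (a : ZMod 2) : sgn a * sgn a = 1 := by
  rcases zmod_two_cases a with rfl | rfl <;> simp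

lemma conj_sgn (a : ZMod 2) : conj (sgn a) = sgn a := by
  rcases zmod_two_cases a with rfl | rfl <;> simp

lemma norm_sgn (a : ZMod 2) : ‖sgn a‖ = 1 := by
  rcases zmod_two_cases a with rfl | rfl <;> simp

lemma sgn_sum {ι : Type*} (s : Finset ι) (g : ι → ZMod 2) :
    sgn (∑ i ∈ s, g i) = ∏ i ∈ s, sgn (g i) := by
  classical
  induction s using Finset.induction_on with
  | empty => simp
  | insert i s hi ih => rw [Finset.sum_insert hi, Finset.prod_insert hi, sgn_add, ih]

lemma zmod_two_add_self {V : Type*} (z d : V → ZMod 2) : z + d + d = z := by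
  funext v
  simp [add_assoc, CharTwo.add_self_eq_zero]

/-! ### Controlled-`Z` signs -/

section CZ

variable {V : Type*}

lemma czSign_mk (u v : V) (z : V → ZMod 2) : czSign s(u, v) z = sgn (z u * z v) := by
  unfold czSign
  rcases zmod_two_cases (z u) with hu | hu <;> rcases zmod_two_cases (z v) with hv | hv <;>
    simp [hu, hv]

variable [Fintype V]

/-- The product of the controlled-`Z` signs of all edges. -/
noncomputable def graphSign (G : SimpleGraph V) [DecidableRel G.Adj] (z : V → ZMod 2) : ℂ :=
  ∏ e ∈ G.edgeFinset, czSign e z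

lemma exists_graphSign_eq (G : SimpleGraph V) [DecidableRel G.Adj] (z : V → ZMod 2) :
    ∃ t, graphSign G z = sgn t := by
  have h : ∀ e : Sym2 V, ∃ t, czSign e z = sgn t := fun e => by
    induction e with | _ u v => exact ⟨_, czSign_mk u v z⟩
  choose t ht using h
  exact ⟨∑ e ∈ G.edgeFinset, t e, by simp [graphSign, ht, sgn_sum]⟩

variable [DecidableEq V]

/-- Double counting of darts: fibred over the source they give the neighbour sums, fibred over the
edge they come in pairs `d`, `d.symm`. -/
lemma sum_edgeFinset_eq_sum_adj {M : Type*} [AddCommMonoid M] (G : SimpleGraph V)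
    [DecidableRel G.Adj] (F : V → V → M) (H : Sym2 V → M)
    (hH : ∀ u v, G.Adj u v → H s(u, v) = F u v + F v u) :
    ∑ e ∈ G.edgeFinset, H e = ∑ u, ∑ v ∈ G.neighborFinset u, F u v := by
  have h1 : ∑ u, ∑ v ∈ G.neighborFinset u, F u v = ∑ d : G.Dart, F d.fst d.snd := by
    rw [← Finset.sum_fiberwise (s := (Finset.univ : Finset G.Dart)) (g := fun d => d.fst)]
    refine Finset.sum_congr rfl fun u _ => ?_
    refine Finset.sum_bij' (fun v hv => (⟨(u, v), by simpa using hv⟩ : G.Dart))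
      (fun d _ => d.snd) ?_ ?_ ?_ ?_ ?_
    · intro v hv; simp
    · intro d hd
      have hd' : d.fst = u := by simpa using hd
      simp [← hd', d.adj]
    · intro v hv; rfl
    · intro d hd
      have hd' : d.fst = u := by simpa using hd
      subst hd'; rfl
    · intro v hv; rfl
  have h2 : ∑ d : G.Dart, F d.fst d.snd = ∑ e ∈ G.edgeFinset, H e := by
    rw [← Finset.sum_fiberwise_of_maps_to (s := (Finset.univ : Finset G.Dart))
      (t := G.edgeFinset) (g := fun d => d.edge) (fun d _ => by simp [d.edge_mem])]
    refine Finset.sum_congr rfl fun e he => ?_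
    induction e with
    | _ u v =>
      have hadj : G.Adj u v := by simpa using he
      let d : G.Dart := ⟨(u, v), hadj⟩
      have : (Finset.univ.filter fun d' : G.Dart => d'.edge = s(u, v)) = {d, d.symm} :=
        d.edge_fiber
      rw [this, Finset.sum_pair d.symm_ne.symm, hH u v hadj]
      rfl
  rw [h1, h2]

/-- Polarization of the quadratic form `∑ z u * z v` over the edges; the cross term is how a shift
by `X` spreads as `Z` to the neighbours. -/
lemma graphSign_add (G : SimpleGraph V) [DecidableRel G.Adj] (z d : V → ZMod 2) :
    graphSign G (z + d) =
      graphSign G z * graphSign G d * sgn (∑ u, z u * ∑ v ∈ G.neighborFinset u, d v) := by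
  -- The exponent is pinned down for every ordered representative of `e`, so that the chosen `t` is
  -- a usable function of the unordered edge.
  have h : ∀ e : Sym2 V, ∃ t, (∀ u v, e = s(u, v) → t = z u * d v + z v * d u) ∧
      czSign e (z + d) = czSign e z * czSign e d * sgn t := fun e => by
    induction e with
    | _ u v =>
      refine ⟨z u * d v + z v * d u, ?_, ?_⟩
      · intro u' v' h
        rcases Sym2.eq_iff.mp h with ⟨rfl, rfl⟩ | ⟨rfl, rfl⟩
        · rfl
        · ring
      · rw [czSign_mk, czSign_mk, czSign_mk, ← sgn_add, ← sgn_add]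
        congr 1
        simp only [Pi.add_apply]; ring
  choose t ht h using h
  have := sum_edgeFinset_eq_sum_adj G (fun u v => z u * d v) t (fun u v _ => ht _ u v rfl)
  simp only [Finset.mul_sum]
  rw [← this, sgn_sum]
  simp only [graphSign, h, Finset.prod_mul_distrib]

end CZ

/-! ### The operator of the open graph state with measurements -/

/-- Outcome `m` amounts to a `Z^m` followed by the projection with outcome `0`. -/
lemma ket_eq_sgn_mul (α : ℝ) (m : ZMod 2) (b : ZMod 2) :
    ket α m b = sgn (b * m) * ket α 0 b := by
  rcases zmod_two_cases b with rfl | rfl <;> simp [ket, sgn]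
  ring

lemma plus_eq (b : ZMod 2) : plus b = (Real.sqrt 2 : ℂ)⁻¹ := by
  simp [plus, ket]

lemma sqrt_two_ne_zero : (Real.sqrt 2 : ℂ) ≠ 0 := by simp

lemma sqrt_two_mul_self : (Real.sqrt 2 : ℂ) * (Real.sqrt 2 : ℂ) = 2 := by
  rw [← Complex.ofReal_mul, Real.mul_self_sqrt (by norm_num)]; simp

lemma IsFlow.lt {V : Type*} [PartialOrder V] {G : SimpleGraph V} {I O : Finset V}
    {f : {v // v ∉ O} → {v // v ∉ I}} (hf : IsFlow G I O f) (i : {v // v ∉ O}) :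
    (i : V) < f i :=
  lt_of_le_of_ne (hf.le i) (hf.adj i).ne

section Graphs

variable {V : Type*} [Fintype V] [DecidableEq V]

/-- The phase `∏_i e^{-i a_i z_i}`. -/
noncomputable def anglePhase (O : Finset V) (a : {v // v ∉ O} → ℝ) (z : V → ZMod 2) : ℂ :=
  ∏ i : {v // v ∉ O}, ((Real.sqrt 2 : ℂ) * conj (ket (a i) 0 (z i)))

lemma ket_phase_mul_conj (α : ℝ) (b : ZMod 2) :
    conj ((Real.sqrt 2 : ℂ) * conj (ket α 0 b)) * ((Real.sqrt 2 : ℂ) * conj (ket α 0 b)) = 1 := by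
  have h2 := sqrt_two_ne_zero
  rcases zmod_two_cases b with rfl | rfl
  · simp [ket]
  · simp [ket]
    field_simp
    rw [← Complex.exp_conj, ← Complex.exp_add]; simp

lemma conj_anglePhase_mul_self (O : Finset V) (a : {v // v ∉ O} → ℝ) (z : V → ZMod 2) :
    conj (anglePhase O a z) * anglePhase O a z = 1 := by
  simp only [anglePhase, map_prod, ← Finset.prod_mul_distrib, ket_phase_mul_conj,
    Finset.prod_const_one]

lemma path_operator_apply (G : SimpleGraph V) [DecidableRel G.Adj] (I O : Finset V)
    (a : {v // v ∉ O} → ℝ) (y : {v // v ∈ O} → ZMod 2) (x : {v // v ∈ I} → ZMod 2) :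
    (plusBras O a * globalEnt G * globalPrep I) y x =
      ∑ z : V → ZMod 2, if (fun v : {v // v ∈ O} => z v) = y ∧ (fun v : {v // v ∈ I} => z v) = x
        then (Real.sqrt 2 : ℂ)⁻¹ ^ (Iᶜ).card * graphSign G z *
          ∏ i : {v // v ∉ O}, conj (ket (a i) 0 (z i)) else 0 := by
  rw [Matrix.mul_apply]
  refine Finset.sum_congr rfl fun z _ => ?_
  rw [globalEnt, Matrix.mul_diagonal]
  simp only [plusBras, globalPrep, Matrix.of_apply, plus_eq, Finset.prod_const]
  by_cases h1 : (fun v : {v // v ∈ O} => z v) = y <;>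
    by_cases h2 : (fun v : {v // v ∈ I} => z v) = x <;> simp [h1, h2, graphSign]
  ring

/-- The factor `√2 ^ |Oᶜ|` normalizes the bras, so each path has an amplitude of modulus one and
only the preparations contribute to the prefactor. -/
lemma flowUnitary_apply (G : SimpleGraph V) [DecidableRel G.Adj] (I O : Finset V)
    (a : {v // v ∉ O} → ℝ) (y : {v // v ∈ O} → ZMod 2) (x : {v // v ∈ I} → ZMod 2) :
    flowUnitary G I O a y x = (Real.sqrt 2 : ℂ)⁻¹ ^ (Iᶜ).card *
      ∑ z : V → ZMod 2, if (fun v : {v // v ∈ O} => z v) = y ∧ (fun v : {v // v ∈ I} => z v) = x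
        then graphSign G z * anglePhase O a z else 0 := by
  have hc : (Oᶜ).card = (Finset.univ : Finset {v // v ∉ O}).card := by
    rw [Finset.card_univ, Fintype.card_subtype_compl]
    simp [Finset.card_compl]
  rw [flowUnitary, Matrix.smul_apply, path_operator_apply, smul_eq_mul, Finset.mul_sum,
    Finset.mul_sum]
  refine Finset.sum_congr rfl fun z _ => ?_
  split_ifs
  · rw [anglePhase, Finset.prod_mul_distrib, Finset.prod_const, hc]; ring
  · simp

/-! ### Unitarity by interference of paths -/

/-- Interference: the contribution of two paths that differ by a nonzero `d` cancels. -/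
lemma sum_path_pair_eq_zero [PartialOrder V] {G : SimpleGraph V} [DecidableRel G.Adj]
    {I O : Finset V} {f : {v // v ∉ O} → {v // v ∉ I}} (hf : IsFlow G I O f)
    (a : {v // v ∉ O} → ℝ) (x : {v // v ∈ I} → ZMod 2) (d : V → ZMod 2)
    (hdO : ∀ v ∈ O, d v = 0) (hd : d ≠ 0) :
    (∑ z : V → ZMod 2, if (fun v : {v // v ∈ I} => z v) = x then
      conj (graphSign G z * anglePhase O a z) *
        (graphSign G (z + d) * anglePhase O a (z + d)) else 0) = 0 := by
  -- A maximal point of the support of `d`. It is not an output, so the flow supplies `p = f i`,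
  -- where the paths get flipped.
  obtain ⟨i, hi, hmax⟩ := (Finset.univ.filter fun v => d v ≠ 0).exists_maximal (by
    obtain ⟨v, hv⟩ := Function.ne_iff.mp hd
    exact ⟨v, by simpa using hv⟩)
  have hi' : d i ≠ 0 := by simpa using hi
  have hgt : ∀ v, i < v → d v = 0 := fun v hv => by
    by_contra h
    exact absurd (hmax (by simpa using h) hv.le) hv.not_ge
  have hiO : i ∉ O := fun h => hi' (hdO i h)
  set p : V := (f ⟨i, hiO⟩ : V) with hp
  have hpI : p ∉ I := (f ⟨i, hiO⟩).2
  have hpd : d p = 0 := hgt p (hf.lt ⟨i, hiO⟩)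
  -- All neighbours of `p` other than `i` lie above `i`, where `d` vanishes by maximality.
  have hN : ∑ v ∈ G.neighborFinset p, d v = 1 := by
    rw [Finset.sum_eq_single i]
    · exact (zmod_two_cases _).resolve_left hi'
    · intro v hv hvi
      have : G.Adj v p := by simpa [SimpleGraph.adj_comm] using hv
      exact hgt v (lt_of_le_of_ne (hf.le_of_adj ⟨i, hiO⟩ v hvi this) (Ne.symm hvi))
    · intro h
      exact absurd (by simpa [SimpleGraph.adj_comm] using hf.adj ⟨i, hiO⟩) h
  set δ : V → ZMod 2 := Pi.single p 1 with hδ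
  set F : (V → ZMod 2) → ℂ := fun z => if (fun v : {v // v ∈ I} => z v) = x then
      conj (graphSign G z * anglePhase O a z) *
        (graphSign G (z + d) * anglePhase O a (z + d)) else 0 with hF
  have hQ : ∀ z, conj (graphSign G z) * graphSign G (z + d) =
      graphSign G d * sgn (∑ u, z u * ∑ v ∈ G.neighborFinset u, d v) := fun z => by
    obtain ⟨t, ht⟩ := exists_graphSign_eq G z
    rw [graphSign_add, ht, conj_sgn, ← mul_assoc, ← mul_assoc, sgn_mul_self, one_mul]
  have hflip : ∀ z, F (z + δ) = -F z := fun z => by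
    have hc : (fun v : {v // v ∈ I} => (z + δ) v) = (fun v : {v // v ∈ I} => z v) := by
      funext v
      have : (v : V) ≠ p := fun h => hpI (h ▸ v.2)
      simp [hδ, this]
    -- Since `d p = 0`, both paths carry the same phase at `p`, and it cancels against its conjugate
    -- before and after the flip.
    have hE : conj (anglePhase O a (z + δ)) * anglePhase O a (z + δ + d) =
        conj (anglePhase O a z) * anglePhase O a (z + d) := by
      simp only [anglePhase, map_prod, ← Finset.prod_mul_distrib]
      refine Finset.prod_congr rfl fun k _ => ?_
      by_cases hk : (k : V) = p
      · have : d k = 0 := by rw [hk, hpd]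
        simp only [Pi.add_apply, this, add_zero, ket_phase_mul_conj]
      · simp [hδ, hk]
    have hS : sgn (∑ u, (z + δ) u * ∑ v ∈ G.neighborFinset u, d v) =
        - sgn (∑ u, z u * ∑ v ∈ G.neighborFinset u, d v) := by
      simp only [Pi.add_apply, add_mul, Finset.sum_add_distrib, sgn_add]
      have : ∑ u, δ u * ∑ v ∈ G.neighborFinset u, d v = 1 := by
        rw [Finset.sum_eq_single p]
        · simp [hδ, hN]
        · intro u _ hu; simp [hδ, hu]
        · simp
      rw [this]; simp
    simp only [hF, hc]
    split_ifs
    · have h1 : ∀ w, conj (graphSign G w * anglePhase O a w) *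
        (graphSign G (w + d) * anglePhase O a (w + d)) =
          (conj (graphSign G w) * graphSign G (w + d)) *
            (conj (anglePhase O a w) * anglePhase O a (w + d)) := fun w => by
        rw [map_mul]; ring
      rw [h1, h1, hQ, hQ, hE, hS]; ring
    · simp
  have : ∑ z, F z = -∑ z, F z := by
    conv_lhs => rw [← Equiv.sum_comp (Equiv.addRight δ)]
    simp [hflip]
  exact self_eq_neg.mp this

lemma card_filter_restrict_eq (I : Finset V) (x : {v // v ∈ I} → ZMod 2) :
    (Finset.univ.filter fun z : V → ZMod 2 => (fun v : {v // v ∈ I} => z v) = x).card =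
      2 ^ (Iᶜ).card := by
  have hc : Fintype.card {v // v ∉ I} = (Iᶜ).card := by
    rw [Fintype.card_subtype_compl]; simp [Finset.card_compl]
  rw [← hc, ← Fintype.card_subtype]
  let e := Equiv.piEquivPiSubtypeProd (fun v => v ∈ I) (fun _ : V => ZMod 2)
  have : {z : V → ZMod 2 // (fun v : {v // v ∈ I} => z v) = x} ≃ ({v // v ∉ I} → ZMod 2) :=
    { toFun := fun z => (e z.1).2
      invFun := fun w => ⟨e.symm (x, w), congrArg Prod.fst (e.apply_symm_apply (x, w))⟩
      left_inv := fun z => Subtype.ext (by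
        have h1 : ((e z.1).1, (e z.1).2) = (x, (e z.1).2) := Prod.ext z.2 rfl
        exact (congrArg e.symm h1).symm.trans (e.symm_apply_apply z.1))
      right_inv := fun w => congrArg Prod.snd (e.apply_symm_apply (x, w)) }
  rw [Fintype.card_congr this]
  simp

/-- The output condition on `w` is stated relative to `z`, so that `y` occurs in one condition only
and summing over `y` removes it. -/
lemma sum_ite_mul_sum_ite (I O : Finset V) (x x' : {v // v ∈ I} → ZMod 2)
    (y : {v // v ∈ O} → ZMod 2) (B A : (V → ZMod 2) → ℂ) (c : ℂ) :
    (c * ∑ z : V → ZMod 2, if (fun v : {v // v ∈ O} => z v) = y ∧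
        (fun v : {v // v ∈ I} => z v) = x then B z else 0) *
      (c * ∑ w : V → ZMod 2, if (fun v : {v // v ∈ O} => w v) = y ∧
        (fun v : {v // v ∈ I} => w v) = x' then A w else 0) =
      ∑ z : V → ZMod 2, ∑ w : V → ZMod 2, if (fun v : {v // v ∈ O} => z v) = y then
        c * c * (if (fun v : {v // v ∈ I} => w v) = x' ∧ (∀ v ∈ O, w v = z v) then
          (if (fun v : {v // v ∈ I} => z v) = x then B z * A w else 0) else 0) else 0 := by
  rw [mul_mul_mul_comm, Finset.sum_mul_sum, Finset.mul_sum]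
  refine Finset.sum_congr rfl fun z _ => ?_
  rw [Finset.mul_sum]
  refine Finset.sum_congr rfl fun w _ => ?_
  by_cases hzy : (fun v : {v // v ∈ O} => z v) = y
  · have h : ((fun v : {v // v ∈ O} => w v) = y) ↔ (∀ v ∈ O, w v = z v) := by
      rw [← hzy, funext_iff]; simp
    rw [if_pos hzy]
    by_cases h1 : (fun v : {v // v ∈ I} => z v) = x
    · rw [if_pos ⟨hzy, h1⟩, if_pos h1]
      by_cases h2 : (fun v : {v // v ∈ I} => w v) = x' ∧ (∀ v ∈ O, w v = z v)
      · rw [if_pos h2, if_pos ⟨h.mpr h2.2, h2.1⟩]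
      · rw [if_neg h2, if_neg fun h' => h2 ⟨h'.2, h.mp h'.1⟩, mul_zero]
    · rw [if_neg fun h' => h1 h'.2, if_neg h1, ite_self, zero_mul]
  · rw [if_neg hzy, if_neg fun h' => hzy h'.1, zero_mul, mul_zero]

theorem conjTranspose_flowUnitary_mul_self [PartialOrder V] {G : SimpleGraph V}
    [DecidableRel G.Adj] {I O : Finset V} {f : {v // v ∉ O} → {v // v ∉ I}}
    (hf : IsFlow G I O f) (a : {v // v ∉ O} → ℝ) :
    (flowUnitary G I O a)ᴴ * flowUnitary G I O a = 1 := by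
  ext x x'
  set A : (V → ZMod 2) → ℂ := fun z => graphSign G z * anglePhase O a z with hA
  have hAA : ∀ z, conj (A z) * A z = 1 := fun z => by
    obtain ⟨t, ht⟩ := exists_graphSign_eq G z
    have := conj_anglePhase_mul_self O a z
    simp only [hA, ht, map_mul, conj_sgn]
    calc _ = (sgn t * sgn t) * (conj (anglePhase O a z) * anglePhase O a z) := by ring
      _ = 1 := by rw [sgn_mul_self, this, one_mul]
  -- The second path is written as `z + d`; agreement of the outputs becomes `d = 0` on `O`.
  have key : ((flowUnitary G I O a)ᴴ * flowUnitary G I O a) x x' =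
      (2⁻¹ : ℂ) ^ (Iᶜ).card * ∑ d : V → ZMod 2, ∑ z : V → ZMod 2,
        if (fun v : {v // v ∈ I} => (z + d) v) = x' ∧ (∀ v ∈ O, d v = 0) then
          (if (fun v : {v // v ∈ I} => z v) = x then conj (A z) * A (z + d) else 0) else 0 := by
    have h2 : (2⁻¹ : ℂ) = (Real.sqrt 2 : ℂ)⁻¹ * (Real.sqrt 2 : ℂ)⁻¹ := by
      rw [← mul_inv, sqrt_two_mul_self]
    rw [Matrix.mul_apply]
    simp only [Matrix.conjTranspose_apply, flowUnitary_apply]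
    rw [Finset.sum_comm, h2, mul_pow, Finset.mul_sum]
    have hz : ∀ z : V → ZMod 2,
        (∑ d : V → ZMod 2, if (fun v : {v // v ∈ I} => (z + d) v) = x' ∧ (∀ v ∈ O, d v = 0) then
          (if (fun v : {v // v ∈ I} => z v) = x then conj (A z) * A (z + d) else 0) else 0) =
        ∑ w : V → ZMod 2, if (fun v : {v // v ∈ I} => w v) = x' ∧ (∀ v ∈ O, w v = z v) then
          (if (fun v : {v // v ∈ I} => z v) = x then conj (A z) * A w else 0) else 0 := by
      intro z
      conv_rhs => rw [← Equiv.sum_comp (Equiv.addLeft z)]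
      refine Finset.sum_congr rfl fun d _ => ?_
      simp
    simp only [hz]
    simp only [star_mul', Complex.star_def, map_sum, map_pow, map_inv₀, Complex.conj_ofReal]
    simp only [apply_ite conj, map_zero]
    rw [Finset.sum_congr rfl fun y _ => sum_ite_mul_sum_ite I O x x' y (fun z => conj (A z)) A _, Finset.sum_comm]
    refine Finset.sum_congr rfl fun z _ => ?_
    rw [Finset.sum_comm, Finset.mul_sum]
    refine Finset.sum_congr rfl fun w _ => ?_
    simp
  rw [key, Finset.sum_eq_single 0]
  · simp only [add_zero, hAA, Pi.zero_apply, implies_true, and_true]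
    by_cases hx : x = x'
    · subst hx
      have : ∀ z : V → ZMod 2, (if (fun v : {v // v ∈ I} => z v) = x then
          (if (fun v : {v // v ∈ I} => z v) = x then (1 : ℂ) else 0) else 0) =
          if (fun v : {v // v ∈ I} => z v) = x then (1 : ℂ) else 0 := fun z => by
        split_ifs <;> rfl
      simp only [this]
      rw [Finset.sum_boole, card_filter_restrict_eq, Matrix.one_apply_eq]
      push_cast
      rw [← mul_pow]; simp
    · rw [Matrix.one_apply_ne hx, Finset.sum_eq_zero, mul_zero]
      intro z _
      split_ifs with h1 h2
      · exact absurd (h2.symm.trans h1) hx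
      all_goals rfl
  · intro d _ hd
    by_cases hdO : ∀ v ∈ O, d v = 0
    · have h0 := sum_path_pair_eq_zero hf a x d hdO hd
      -- Compatibility of `d` with the two inputs does not depend on `z`: either it can be dropped
      -- from the sum or every term vanishes.
      by_cases hxd : ∀ v : {v // v ∈ I}, x v + d v = x' v
      · refine Eq.trans ?_ h0
        refine Finset.sum_congr rfl fun z _ => ?_
        by_cases hz : (fun v : {v // v ∈ I} => z v) = x
        · have : (fun v : {v // v ∈ I} => (z + d) v) = x' := by
            funext v; rw [← hxd v, ← hz]; rfl
          rw [if_pos ⟨this, hdO⟩]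
        · simp [hz]
      · refine Finset.sum_eq_zero fun z _ => ?_
        split_ifs with h1 h2
        · refine absurd (fun v => ?_) hxd
          rw [← h1.1, ← h2]; rfl
        all_goals rfl
    · simp [hdO]
  · simp

/-- With `|I| = |O|` the index types have equal cardinality, so a one-sided inverse is two-sided. -/
theorem flowUnitary_mul_conjTranspose [PartialOrder V] {G : SimpleGraph V}
    [DecidableRel G.Adj] {I O : Finset V} {f : {v // v ∉ O} → {v // v ∉ I}}
    (hf : IsFlow G I O f) (hcard : I.card = O.card) (a : {v // v ∉ O} → ℝ) :
    flowUnitary G I O a * (flowUnitary G I O a)ᴴ = 1 :=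
  (Matrix.mul_eq_one_comm_of_card_eq _ _ _ (by simp [hcard])).mp
    (conjTranspose_flowUnitary_mul_self hf a)

end Graphs

/-- Combined with (R1), this rules out `X`-shifts of a qubit after its measurement. -/
lemma actsOn_of_xDep_ne_zero {V : Type*} {w j : V} {c : Command V} (h : xDep w j c ≠ 0) :
    c.ActsOn w ∧ ¬ c.Prepares w := by
  cases c with
  | meas v α S T =>
    simp only [xDep, ne_eq, ite_eq_right_iff, not_forall] at h
    exact ⟨h.1.1, id⟩
  | corrX v S =>
    simp only [xDep, ne_eq, ite_eq_right_iff, not_forall] at h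
    exact ⟨h.1.1, id⟩
  | _ => exact absurd rfl h

lemma czSign_congr {V : Type*} (e : Sym2 V) {z x : V → ZMod 2} (h : ∀ v ∈ e, z v = x v) :
    czSign e z = czSign e x := by
  unfold czSign
  have : (∀ v ∈ e, z v = 1) ↔ ∀ v ∈ e, x v = 1 :=
    forall₂_congr fun v hv => by rw [h v hv]
  by_cases hx : ∀ v ∈ e, x v = 1
  · rw [if_pos hx, if_pos (this.mpr hx)]
  · rw [if_neg hx, if_neg fun h' => hx (this.mp h')]

lemma run_append {V : Type*} [DecidableEq V] (s : V → ZMod 2) (Q R : List (Command V)) (ψ : (V → ZMod 2) → ℂ) :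
    run s (Q ++ R) ψ = run s R (run s Q ψ) := by
  simp [run]

lemma act_const_mul {V : Type*} [DecidableEq V] (s : V → ZMod 2) (c : Command V) (γ : ℂ) (ψ : (V → ZMod 2) → ℂ)
    (x : V → ZMod 2) : c.act s (fun x => γ * ψ x) x = γ * c.act s ψ x := by
  cases c <;> simp only [Command.act, Finset.mul_sum]
  case meas => exact Finset.sum_congr rfl fun b _ => by ring
  all_goals ring

section PathSum

variable {V : Type*} [Fintype V]

/-! ### The path sum of a pattern -/

/-- The total `X`-correction of the qubit `w` in a command sequence. -/
noncomputable def xShift (s : V → ZMod 2) (Q : List (Command V)) (w : V) : ZMod 2 :=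
  ∑ j, (Q.map (xDep w j)).sum * s j

/-- The total `Z`-correction of the qubit `w` in a command sequence. -/
noncomputable def zShift (s : V → ZMod 2) (Q : List (Command V)) (w : V) : ZMod 2 :=
  ∑ j, (Q.map (zDep w j)).sum * s j

lemma xShift_append (s : V → ZMod 2) (Q R : List (Command V)) (w : V) :
    xShift s (Q ++ R) w = xShift s Q w + xShift s R w := by
  simp [xShift, add_mul, Finset.sum_add_distrib]

lemma zShift_cons (s : V → ZMod 2) (c : Command V) (Q : List (Command V)) (w : V) :
    zShift s (c :: Q) w = zShift s [c] w + zShift s Q w := by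
  simp [zShift, add_mul, Finset.sum_add_distrib]

lemma zShift_singleton_eq_zero (s : V → ZMod 2) (c : Command V) (h : ∀ w j, zDep w j c = 0)
    (w : V) : zShift s [c] w = 0 := by
  simp [zShift, h]

lemma xShift_eq_zero (s : V → ZMod 2) (Q : List (Command V)) (w : V)
    (h : ∀ c ∈ Q, ∀ j, xDep w j c = 0) : xShift s Q w = 0 := by
  refine Finset.sum_eq_zero fun j _ => ?_
  rw [List.sum_eq_zero, zero_mul]
  intro x hx
  obtain ⟨c, hc, rfl⟩ := List.mem_map.mp hx
  exact h c hc j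

/-- An unmeasured qubit can have been shifted only by a Pauli correction, and none precedes an
entangling command on it. Hence controlled-`Z` sees the unshifted path. -/
lemma xShift_eq_zero_of_forall_mem (s : V → ZMod 2) (e : Sym2 V) (Q : List (Command V)) (w : V)
    (hw : w ∈ e) (hm : ¬ ∃ d ∈ Q, d.Measures w)
    (hent : ∀ d ∈ Q, d.Corrects w → w ∉ e) : xShift s Q w = 0 := by
  refine xShift_eq_zero s Q w fun d hd j => ?_
  cases d with
  | meas v α S T =>
    simp only [xDep]
    rw [if_neg]
    rintro ⟨rfl, -⟩
    exact hm ⟨_, hd, rfl⟩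
  | corrX v S =>
    simp only [xDep]
    rw [if_neg]
    rintro ⟨rfl, -⟩
    exact hent _ hd rfl hw
  | _ => rfl

open Classical in
lemma sum_ite_mul_eq_signal (s : V → ZMod 2) (w v : V) (S : Finset V) :
    ∑ j, (if w = v ∧ j ∈ S then 1 else 0) * s j = if w = v then signal s S else 0 := by
  by_cases h : w = v <;> simp [h, signal, Finset.sum_ite_mem]

variable [DecidableEq V]

open Classical in
/-- The sum of `g` over all paths `z` that end, outside of `m`, in `x` shifted by `t`. -/
noncomputable def pathSum (m : V → Prop) (t : V → ZMod 2) (g : (V → ZMod 2) → ℂ)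
    (x : V → ZMod 2) : ℂ :=
  ∑ z : V → ZMod 2, if ∀ v, m v ∨ z v = x v + t v then g z else 0

lemma mul_pathSum_eq {m m' : V → Prop} {t t' x x' : V → ZMod 2} {g g' : (V → ZMod 2) → ℂ} {c : ℂ}
    (h : ∀ z : V → ZMod 2, (∀ v, m v ∨ z v = x v + t v) ↔ ∀ v, m' v ∨ z v = x' v + t' v)
    (hg : ∀ z, (∀ v, m v ∨ z v = x v + t v) → c * g z = g' z) :
    c * pathSum m t g x = pathSum m' t' g' x' := by
  unfold pathSum
  rw [Finset.mul_sum]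
  refine Finset.sum_congr rfl fun z _ => ?_
  by_cases hz : ∀ v, m v ∨ z v = x v + t v
  · rw [if_pos hz, if_pos ((h z).mp hz), hg z hz]
  · rw [if_neg hz, if_neg fun h' => hz ((h z).mpr h'), mul_zero]

/-- Measuring `v` frees the path at `v`: a path `z` meets the end condition for the single value `b
= z v + t v`. -/
lemma sum_mul_pathSum_update {m : V → Prop} {t : V → ZMod 2}
    {g : (V → ZMod 2) → ℂ} {v : V} (hv : ¬ m v) (k : ZMod 2 → ℂ) (x : V → ZMod 2) :
    ∑ b : ZMod 2, k b * pathSum m t g (Function.update x v b) =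
      pathSum (fun u => m u ∨ u = v) t (fun z => k (z v + t v) * g z) x := by
  unfold pathSum
  simp only [Finset.mul_sum]
  rw [Finset.sum_comm]
  refine Finset.sum_congr rfl fun z _ => ?_
  have htt : t v + t v = 0 := CharTwo.add_self_eq_zero _
  rw [Finset.sum_eq_single (z v + t v)]
  · have : (∀ u, m u ∨ z u = Function.update x v (z v + t v) u + t u) ↔
        ∀ u, (m u ∨ u = v) ∨ z u = x u + t u := by
      refine forall_congr' fun u => ?_
      by_cases hu : u = v
      · subst hu; simp [add_assoc, htt]
      · simp [hu]
    by_cases hall : ∀ u, (m u ∨ u = v) ∨ z u = x u + t u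
    · rw [if_pos hall, if_pos (this.mpr hall)]
    · rw [if_neg hall, if_neg fun h' => hall (this.mp h'), mul_zero]
  · intro b _ hb
    rw [if_neg, mul_zero]
    intro h
    have := (h v).resolve_left hv
    rw [Function.update_self] at this
    exact hb (by rw [this, add_assoc, htt, add_zero])
  · simp

end PathSum

/-! ### Adaptive measurements -/

/-- An adaptive measurement is a plain one preceded by `X^S Z^T`: negating the angle swaps the two
amplitudes up to a phase, and adding `π` flips the sign of the second. -/
lemma exists_ket_eq (α : ℝ) (S T m : ZMod 2) : ∃ γ : ℂ, ‖γ‖ = 1 ∧ ∀ b,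
    ket ((-1) ^ S.val * α + T.val * Real.pi) m b = γ * (sgn (b * T) * ket α m (b + S)) := by
  have h11 : (1 : ZMod 2) + 1 = 0 := by decide
  have hn : ∀ x : ℝ, ‖Complex.exp (x * Complex.I)‖ = 1 := Complex.norm_exp_ofReal_mul_I
  rcases zmod_two_cases S with rfl | rfl
  · refine ⟨1, by simp, fun b => ?_⟩
    rcases zmod_two_cases b with rfl | rfl <;> rcases zmod_two_cases T with rfl | rfl <;>
      simp [ket, sgn, ZMod.val_one, add_mul, Complex.exp_add]
    ring
  -- The phase `± e^{-iα}` is what is left after factoring the swapped vector out of the vector of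
  -- angle `-α`.
  · refine ⟨sgn m * Complex.exp ((-α : ℝ) * Complex.I), by rw [norm_mul, norm_sgn, hn, one_mul],
      fun b => ?_⟩
    have hm : (-1 : ℂ) ^ m.val = sgn m := rfl
    have he : Complex.exp (-(α * Complex.I)) * Complex.exp (α * Complex.I) = 1 := by
      rw [← Complex.exp_add]; simp
    have hmm := sgn_mul_self m
    rcases zmod_two_cases b with rfl | rfl
    · simp only [ket, zero_mul, sgn_zero, zero_add, if_true, one_ne_zero, if_false, one_mul, hm]
      push_cast
      rw [neg_mul]
      calc _ = (sgn m * sgn m) * (Complex.exp (-(α * Complex.I)) * Complex.exp (α * Complex.I)) /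
            (Real.sqrt 2 : ℂ) := by rw [hmm, he, one_mul]
        _ = _ := by ring
    · rcases zmod_two_cases T with rfl | rfl <;>
        simp [ket, h11, hm, ZMod.val_one, add_mul, Complex.exp_add] <;> ring

/-! ### Commands acting on path sums -/

section Run

variable {V : Type*} [Fintype V] [DecidableEq V]

/-- The factor that a command contributes to the weight of the path `z` when `X` is the total
`X`-correction of the pattern. -/
noncomputable def Command.weight (s X z : V → ZMod 2) : Command V → ℂ
  | prep _ _ => (Real.sqrt 2 : ℂ)⁻¹
  | ent e => czSign e z
  | meas v α _ T => sgn (z v * signal s T) * conj (ket α (s v) (z v + X v))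
  | corrX _ _ => 1
  | corrZ v S => sgn (z v * signal s S)

/-- A single command acting on a path sum. -/
lemma act_pathSum (s X : V → ZMod 2) (c : Command V) (m : V → Prop) (t : V → ZMod 2)
    (hprep : ∀ v q, c = prep v q → q = plus)
    (hent : ∀ e, c = ent e → ∀ v ∈ e, ¬ m v ∧ t v = 0)
    (hmeas : ∀ v α S T, c = meas v α S T → ¬ m v ∧ t v + signal s S = X v)
    (hZ : ∀ v S, c = corrZ v S → ¬ m v) :
    ∃ γ : ℂ, ‖γ‖ = 1 ∧ ∀ g x, c.act s (pathSum m t g) x =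
      γ * pathSum (fun v => m v ∨ c.Measures v) (fun v => t v + xShift s [c] v)
        (fun z => g z * c.weight s X z) x := by
  cases c with
  | prep v q =>
    refine ⟨1, by simp, fun g x => ?_⟩
    rw [hprep v q rfl, one_mul]
    refine mul_pathSum_eq (fun z => ?_) fun z _ => ?_
    · simp [Measures, xShift, xDep]
    · rw [plus_eq, weight, mul_comm]
  | ent e =>
    refine ⟨1, by simp, fun g x => ?_⟩
    rw [one_mul]
    refine mul_pathSum_eq (fun z => ?_) fun z hz => ?_
    · simp [Measures, xShift, xDep]
    · rw [weight, mul_comm, czSign_congr e (z := z) (x := x)]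
      intro v hv
      obtain ⟨h1, h2⟩ := hent e rfl v hv
      rw [(hz v).resolve_left h1, h2, add_zero]
  | meas v α S T =>
    obtain ⟨hm, hX⟩ := hmeas v α S T rfl
    obtain ⟨γ, hγ, hk⟩ := exists_ket_eq α (signal s S) (signal s T) (s v)
    -- The ket is evaluated at `z v + t v`; the part of its sign involving `t v` is the same for all
    -- paths and joins the global phase.
    refine ⟨conj γ * sgn (t v * signal s T), ?_, fun g x => ?_⟩
    · rw [norm_mul, norm_sgn, RCLike.norm_conj, hγ, one_mul]
    · simp only [Command.act]
      rw [sum_mul_pathSum_update hm]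
      rw [← one_mul (pathSum _ _ _ _)]
      refine Eq.trans (mul_pathSum_eq (m' := fun u => m u ∨ (meas v α S T).Measures u)
        (t' := fun u => t u + xShift s [meas v α S T] u) (x' := x) (fun z => ?_)
          (fun z _ => rfl)) (mul_pathSum_eq (fun z => Iff.rfl) fun z _ => ?_).symm
      · refine forall_congr' fun u => ?_
        by_cases hu : u = v
        · simp [hu, Measures]
        · simp [hu, Measures, xShift, xDep]
      · rw [hk, weight, map_mul, map_mul, conj_sgn, one_mul, add_mul, sgn_add, add_assoc, hX]
        ring
  | corrX v S =>
    refine ⟨1, by simp, fun g x => ?_⟩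
    simp only [Command.act]
    refine (one_mul _).symm.trans ((mul_pathSum_eq (fun z => ?_) fun z _ => ?_).trans
      (one_mul _).symm)
    swap
    · simp [weight]
    refine forall_congr' fun u => ?_
    simp only [xShift, xDep, List.map_cons, List.map_nil, List.sum_cons, List.sum_nil, add_zero,
      Measures, or_false, sum_ite_mul_eq_signal]
    by_cases hu : u = v
    · subst hu
      simp only [Function.update_self, if_true]
      rw [add_assoc, add_comm (signal s S)]
    · simp [hu]
  | corrZ v S =>
    refine ⟨sgn (t v * signal s S), norm_sgn _, fun g x => ?_⟩
    refine Eq.trans (mul_pathSum_eq (m' := m) (t' := t) (x' := x) (fun z => Iff.rfl)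
      (fun z _ => rfl)) (mul_pathSum_eq (fun z => ?_) fun z hz => ?_).symm
    · simp [Measures, xShift, xDep]
    · have hv : z v = x v + t v := by
        have := (hz v).resolve_left (by simpa [Measures] using hZ v S rfl)
        simpa [xShift, xDep] using this
      change _ = sgn (x v * signal s S) * g z
      rw [weight, hv, add_mul, sgn_add]
      calc _ = (sgn (t v * signal s S) * sgn (t v * signal s S)) * (sgn (x v * signal s S) * g z) := by
            ring
        _ = _ := by rw [sgn_mul_self, one_mul]

/-- Induction on the executed prefix `Q`. The weights refer to the total shift of all of `P`, not of
`Q`, so that they do not change as the prefix grows. -/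
theorem run_eq_pathSum {I O : Finset V} {P : List (Command V)} (hP : Runnable I O P)
    (hprep : ∀ v q, prep v q ∈ P → q = plus)
    (hent : P.Pairwise fun c d => ∀ v e, c.Corrects v → d = ent e → v ∉ e)
    (s : V → ZMod 2) (Q : List (Command V)) :
    ∀ R, P = Q ++ R → ∃ γ : ℂ, ‖γ‖ = 1 ∧ ∀ ψ x, run s Q ψ x =
      γ * pathSum (fun v => ∃ d ∈ Q, d.Measures v) (xShift s Q)
        (fun z => ψ z * (Q.map (weight s (xShift s P) z)).prod) x := by
  induction Q using List.reverseRecOn with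
  | nil =>
    intro R _
    refine ⟨1, by simp, fun ψ x => ?_⟩
    simp [run, pathSum, xShift, ← funext_iff]
  | append_singleton Q c ih =>
    intro R hR
    have hR' : P = Q ++ c :: R := by simpa using hR
    obtain ⟨γ, hγ, h⟩ := ih (c :: R) hR'
    obtain ⟨γ', hγ', h'⟩ : ∃ γ' : ℂ, ‖γ'‖ = 1 ∧ ∀ g x,
        c.act s (pathSum (fun v => ∃ d ∈ Q, d.Measures v) (xShift s Q) g) x =
          γ' * pathSum (fun v => (∃ d ∈ Q, d.Measures v) ∨ c.Measures v)
            (fun v => xShift s Q v + xShift s [c] v)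
            (fun z => g z * c.weight s (xShift s P) z) x := by
      apply act_pathSum
      · rintro v q rfl
        exact hprep v q (by simp [hR'])
      · rintro e rfl v hv
        have h1 := (hP.acts Q (ent e) R hR' v hv id).1
        refine ⟨h1, xShift_eq_zero_of_forall_mem s e Q v hv h1 fun d hd hdv => ?_⟩
        rw [hR', List.pairwise_append] at hent
        exact hent.2.2 d hd (ent e) (by simp) v e hdv rfl
      · rintro v α S T rfl
        refine ⟨(hP.acts Q _ R hR' v rfl id).1, ?_⟩
        -- After its measurement `v` is not acted on again, so the shift accumulated so far is
        -- already the total one.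
        have hz : xShift s R v = 0 := xShift_eq_zero s R v fun d hd j => by
          by_contra hne
          obtain ⟨R1, R2, rfl⟩ := List.append_of_mem hd
          obtain ⟨ha, hp⟩ := actsOn_of_xDep_ne_zero hne
          exact (hP.acts (Q ++ meas v α S T :: R1) d R2 (by simp [hR']) v ha hp).1
            ⟨meas v α S T, by simp, rfl⟩
        rw [hR', xShift_append, ← List.singleton_append, xShift_append, hz, add_zero]
        congr 1
        simp [xShift, xDep, signal, Finset.sum_ite_mem]
      · rintro v S rfl
        exact (hP.acts Q _ R hR' v rfl id).1
    refine ⟨γ * γ', by rw [norm_mul, hγ, hγ', one_mul], fun ψ x => ?_⟩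
    have hfun : run s Q ψ = fun x => γ * pathSum (fun v => ∃ d ∈ Q, d.Measures v) (xShift s Q)
        (fun z => ψ z * (Q.map (weight s (xShift s P) z)).prod) x := funext (h ψ)
    rw [run_append, hfun]
    change c.act s _ x = _
    rw [act_const_mul, h', mul_assoc]
    congr 2
    have h1 : (fun v => (∃ d ∈ Q, d.Measures v) ∨ c.Measures v) =
        fun v => ∃ d ∈ Q ++ [c], d.Measures v := by
      funext v
      simp [or_and_right, exists_or]
    have h2 : (fun v => xShift s Q v + xShift s [c] v) = xShift s (Q ++ [c]) :=
      funext fun v => (xShift_append s Q [c] v).symm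
    rw [← mul_one (pathSum _ _ _ x), h1, h2]
    simp [mul_assoc]

end Run

section FlowPatterns

variable {V : Type*} [Fintype V] [DecidableEq V]

/-! ### The branches of a runnable flow pattern -/

/-- The scalar weights commute, so the order of the commands disappears and only the data recorded
in `IsFlowPattern` remain. -/
lemma prod_map_weight (s X z : V → ZMod 2) (P : List (Command V)) :
    (P.map (weight s X z)).prod =
      ((P.filterMap prepData).map fun _ => (Real.sqrt 2 : ℂ)⁻¹).prod *
      ((P.filterMap entData).map fun e => czSign e z).prod *
      ((P.filterMap measData).map fun p => conj (ket p.2 (s p.1) (z p.1 + X p.1))).prod *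
      sgn (∑ w, z w * zShift s P w) := by
  induction P with
  | nil => simp [zShift]
  | cons c P ih =>
    simp only [zShift_cons s c P, mul_add, Finset.sum_add_distrib, sgn_add, List.map_cons,
      List.prod_cons, ih]
    cases c with
    | prep v q =>
      simp only [weight, prepData, entData, measData, List.filterMap_cons, List.map_cons,
        List.prod_cons, zShift_singleton_eq_zero s (prep v q) fun _ _ => rfl, mul_zero,
        Finset.sum_const_zero, sgn_zero, one_mul, mul_assoc]
    | ent e =>
      simp only [weight, prepData, entData, measData, List.filterMap_cons, List.map_cons,
        List.prod_cons, zShift_singleton_eq_zero s (ent e) fun _ _ => rfl, mul_zero,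
        Finset.sum_const_zero, sgn_zero, one_mul]
      ring
    | meas v α S T =>
      have h : ∀ w, zShift s [meas v α S T] w = if w = v then signal s T else 0 := fun w => by
        by_cases hw : w = v <;> simp [zShift, zDep, hw, signal, Finset.sum_ite_mem]
      simp only [weight, prepData, entData, measData, List.filterMap_cons, List.map_cons,
        List.prod_cons, h, mul_ite, mul_zero, Finset.sum_ite_eq', Finset.mem_univ, if_true]
      ring
    | corrX v S =>
      simp only [weight, prepData, entData, measData, List.filterMap_cons,
        zShift_singleton_eq_zero s (corrX v S) fun _ _ => rfl, mul_zero,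
        Finset.sum_const_zero, sgn_zero, one_mul]
    | corrZ v S =>
      have h : ∀ w, zShift s [corrZ v S] w = if w = v then signal s S else 0 := fun w => by
        by_cases hw : w = v <;> simp [zShift, zDep, hw, signal, Finset.sum_ite_mem]
      simp only [weight, prepData, entData, measData, List.filterMap_cons,
        h, mul_ite, mul_zero, Finset.sum_ite_eq', Finset.mem_univ, if_true]
      ring

lemma IsFlowPattern.prod_map_weight {G : SimpleGraph V} [DecidableRel G.Adj] {I O : Finset V}
    {f : {v // v ∉ O} → {v // v ∉ I}} {a : {v // v ∉ O} → ℝ} {P : List (Command V)}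
    (hP : IsFlowPattern G I O f a P) (s X z : V → ZMod 2) :
    (P.map (weight s X z)).prod = (Real.sqrt 2 : ℂ)⁻¹ ^ (Iᶜ).card * graphSign G z *
      (∏ i : {v // v ∉ O}, conj (ket (a i) (s i) (z i + X i))) *
      sgn (∑ w, z w * zShift s P w) := by
  rw [MBQC.prod_map_weight]
  congr 1
  have h1 := congrArg (fun M => (M.map fun _ => (Real.sqrt 2 : ℂ)⁻¹).prod) hP.preps
  have h2 := congrArg (fun M => (M.map fun e => czSign e z).prod) hP.ents
  have h3 := congrArg (fun M => (M.map fun p : V × ℝ =>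
    conj (ket p.2 (s p.1) (z p.1 + X p.1))).prod) hP.meass
  simp only [Multiset.map_coe, Multiset.prod_coe, Multiset.map_map, Function.comp_def] at h1 h2 h3
  rw [h1, h2, h3]
  simp [graphSign, Finset.prod_map_val]

lemma IsFlowPattern.eq_plus_of_prep_mem {G : SimpleGraph V} [DecidableRel G.Adj] {I O : Finset V}
    {f : {v // v ∉ O} → {v // v ∉ I}} {a : {v // v ∉ O} → ℝ} {P : List (Command V)}
    (hP : IsFlowPattern G I O f a P) {v : V} {q : ZMod 2 → ℂ} (h : prep v q ∈ P) : q = plus := by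
  have : (v, q) ∈ (P.filterMap prepData : Multiset (V × (ZMod 2 → ℂ))) := by
    rw [Multiset.mem_coe, List.mem_filterMap]
    exact ⟨_, h, rfl⟩
  rw [hP.preps, Multiset.mem_map] at this
  obtain ⟨w, -, hw⟩ := this
  exact (congrArg Prod.snd hw).symm

/-- The stabilizer relation: the `X`-corrections of a flow pattern generate its `Z`-corrections,
up to a sign flip of each measured qubit. -/
lemma IsFlowPattern.sum_xShift_neighbors [PartialOrder V] {G : SimpleGraph V} [DecidableRel G.Adj]
    {I O : Finset V} {f : {v // v ∉ O} → {v // v ∉ I}} (hf : IsFlow G I O f)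
    {a : {v // v ∉ O} → ℝ} {P : List (Command V)} (hP : IsFlowPattern G I O f a P)
    (s : V → ZMod 2) (hs : ∀ v ∈ O, s v = 0) (u : V) :
    ∑ v ∈ G.neighborFinset u, xShift s P v = zShift s P u + s u := by
  classical
  -- Both sides become linear in the outcomes and can be compared coefficient by coefficient.
  have hu : s u = ∑ j, (if u = j then 1 else 0) * s j := by simp
  rw [hu]
  simp only [xShift, zShift, hP.xDeps, hP.zDeps]
  rw [Finset.sum_comm, ← Finset.sum_add_distrib]
  refine Finset.sum_congr rfl fun j _ => ?_
  rw [← Finset.sum_mul, ← add_mul]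
  by_cases hj : j ∈ O
  · rw [hs j hj, mul_zero, mul_zero]
  · congr 1
    have h1 : ∀ v, (∃ h : j ∉ O, (f ⟨j, h⟩ : V) = v) ↔ (f ⟨j, hj⟩ : V) = v :=
      fun v => ⟨fun ⟨_, h⟩ => h, fun h => ⟨hj, h⟩⟩
    have h2 : (∃ h : j ∉ O, G.Adj (f ⟨j, h⟩) u ∧ u ≠ j) ↔ G.Adj (f ⟨j, hj⟩) u ∧ u ≠ j :=
      ⟨fun ⟨_, h⟩ => h, fun h => ⟨hj, h⟩⟩
    have h3 := hf.adj ⟨j, hj⟩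
    simp only [h1, h2, Finset.sum_ite_eq, SimpleGraph.mem_neighborFinset]
    -- The measured qubit `j` is itself a neighbour of `f j` but receives no `Z`-correction; this
    -- accounts for the extra term `s u`.
    by_cases huj : u = j
    · subst huj; simp [h3]
    · simp [huj, SimpleGraph.adj_comm]

/-- After the substitution `z ↦ z + X` every sign that depends on both the path and the outcomes
occurs twice, so all branches reduce to the same path sum. -/
theorem exists_branch_eq [PartialOrder V] {G : SimpleGraph V} [DecidableRel G.Adj]
    {I O : Finset V} {f : {v // v ∉ O} → {v // v ∉ I}} (hf : IsFlow G I O f)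
    {a : {v // v ∉ O} → ℝ} {P : List (Command V)} (hP : IsFlowPattern G I O f a P)
    (hR : Runnable I O P) (s : {v // v ∉ O} → ZMod 2) :
    ∃ γ : ℂ, ‖γ‖ = 1 ∧ branch I O P s =
      (γ / (Real.sqrt 2 : ℂ) ^ (Oᶜ).card) • flowUnitary G I O a := by
  classical
  set σ : V → ZMod 2 := extendZero (fun v => v ∉ O) s with hσ
  have hσO : ∀ v ∈ O, σ v = 0 := fun v hv => by simp [hσ, extendZero, hv]
  set X := xShift σ P with hX
  -- Values of `f` are never inputs, so the shift respects the input condition.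
  have hXI : ∀ v ∈ I, X v = 0 := fun v hv => by
    simp only [hX, xShift, hP.xDeps]
    refine Finset.sum_eq_zero fun j _ => ?_
    rw [if_neg, zero_mul]
    rintro ⟨h, rfl⟩
    exact (f ⟨j, h⟩).2 hv
  have hM : ∀ v, (∃ d ∈ P, d.Measures v) ↔ v ∉ O := hR.measured_iff
  obtain ⟨γ, hγ, hrun⟩ := run_eq_pathSum hR (fun v q h => hP.eq_plus_of_prep_mem h) hP.ent_before σ
    P [] (by simp)
  rw [← hX] at hrun
  have hstab : ∀ u, ∑ v ∈ G.neighborFinset u, X v = zShift σ P u + σ u :=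
    hP.sum_xShift_neighbors hf σ hσO
  obtain ⟨t, ht⟩ := exists_graphSign_eq G X
  -- The path-independent signs left by the shift: the graph sign of `X` and the `Z`-corrections
  -- evaluated at `X`.
  set δ : ℂ := sgn t * sgn (∑ w, X w * zShift σ P w) with hδ
  refine ⟨γ * δ, by rw [hδ, norm_mul, norm_mul, norm_sgn, norm_sgn, hγ]; simp, ?_⟩
  have hsq : (Real.sqrt 2 : ℂ) ^ (Oᶜ).card ≠ 0 := pow_ne_zero _ sqrt_two_ne_zero
  have hcoef : (γ * δ / (Real.sqrt 2 : ℂ) ^ (Oᶜ).card) • flowUnitary G I O a =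
      (γ * δ) • (plusBras O a * globalEnt G * globalPrep I) := by
    rw [flowUnitary, smul_smul, div_mul_cancel₀ _ hsq]
  rw [hcoef]
  ext y x
  rw [Matrix.smul_apply, path_operator_apply, smul_eq_mul, branch, Matrix.of_apply, hrun, mul_assoc]
  congr 1
  unfold pathSum
  rw [← Equiv.sum_comp (Equiv.addRight X), Finset.mul_sum]
  refine Finset.sum_congr rfl fun z _ => ?_
  have hO : (∀ v, (∃ d ∈ P, d.Measures v) ∨
      (Equiv.addRight X) z v = extendZero (fun v => v ∈ O) y v + X v) ↔
        (fun v : {v // v ∈ O} => z v) = y := by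
    simp only [hM, Equiv.coe_addRight, Pi.add_apply, add_left_inj, ← imp_iff_not_or, funext_iff,
      Subtype.forall]
    refine forall₂_congr fun v hv => ?_
    rw [extendZero, dif_pos hv]
  have hI : (fun v : {v // v ∈ I} => (Equiv.addRight X) z v) = fun v : {v // v ∈ I} => z v := by
    funext v
    simp [hXI v v.2]
  by_cases hy : (fun v : {v // v ∈ O} => z v) = y
  swap
  · rw [if_neg fun h => hy (hO.mp h), if_neg fun h => hy h.1, mul_zero]
  rw [if_pos (hO.mpr hy)]
  beta_reduce
  rw [hI]
  by_cases hx : (fun v : {v // v ∈ I} => z v) = x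
  swap
  · rw [if_neg hx, if_neg fun h => hx h.2, mul_zero, zero_mul]
  rw [if_pos hx, if_pos ⟨hy, hx⟩, hP.prod_map_weight, one_mul, Equiv.coe_addRight, graphSign_add, ht]
  simp only [hstab]
  have hk : ∀ i : {v // v ∉ O}, conj (ket (a i) (σ i) ((z + X) i + X i)) =
      sgn (z i * σ i) * conj (ket (a i) 0 (z i)) := fun i => by
    rw [← Pi.add_apply, zmod_two_add_self, ket_eq_sgn_mul, map_mul, conj_sgn]
  have hσsum : ∑ u, z u * σ u = ∑ i : {v // v ∉ O}, z i * σ i := by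
    rw [← Finset.sum_subtype (Oᶜ) (by simp) (fun u => z u * σ u)]
    refine (Finset.sum_subset (Finset.subset_univ _) fun u _ hu => ?_).symm
    rw [hσO u (by simpa using hu), mul_zero]
  simp only [hk, Finset.prod_mul_distrib]
  rw [← sgn_sum, ← hσsum]
  simp only [mul_add, Finset.sum_add_distrib, sgn_add, Pi.add_apply, add_mul]
  have h1 := sgn_mul_self (∑ u, z u * σ u)
  have h2 := sgn_mul_self (∑ u, z u * zShift σ P u)
  generalize sgn (∑ u, z u * σ u) = p at *
  generalize sgn (∑ u, z u * zShift σ P u) = q at *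
  rw [hδ]
  -- The two sides differ by the factor `p² q²`, where `p` is the outcome sign and `q` the
  -- `Z`-correction sign.
  linear_combination ((Real.sqrt 2 : ℂ)⁻¹ ^ (Iᶜ).card * graphSign G z * sgn t *
    (∏ i : {v // v ∉ O}, conj (ket (a i) 0 (z i))) * sgn (∑ w, X w * zShift σ P w)) *
      (q * q * h1 + h2)

end FlowPatterns

/-! ### Runnability of command sequences built in stages -/

section Stages

variable {V : Type*}

/-- The command `c` may be executed, in a pattern with inputs `I`, after the commands `pre`. -/
def Executable (I : Finset V) (pre : List (Command V)) (c : Command V) : Prop :=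
  (∀ j, c.DependsOn j → ∃ d ∈ pre, d.Measures j) ∧
    ∀ v, c.ActsOn v → ¬ c.Prepares v →
      (¬ ∃ d ∈ pre, d.Measures v) ∧ (v ∈ I ∨ ∃ d ∈ pre, d.Prepares v)

/-- The commands `Q` may be executed one after the other after the commands `pre`. -/
def ExecutableSeq (I : Finset V) (pre Q : List (Command V)) : Prop :=
  ∀ before c after, Q = before ++ c :: after → Executable I (pre ++ before) c

lemma ExecutableSeq.nil (I : Finset V) (pre : List (Command V)) : ExecutableSeq I pre [] :=
  fun _ _ _ h => by simp at h

lemma ExecutableSeq.cons {I : Finset V} {pre Q : List (Command V)} {c : Command V}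
    (hc : Executable I pre c) (hQ : ExecutableSeq I (pre ++ [c]) Q) :
    ExecutableSeq I pre (c :: Q) := by
  intro before d after h
  cases before with
  | nil =>
    obtain ⟨rfl, -⟩ := List.cons.inj h
    simpa using hc
  | cons b before =>
    obtain ⟨rfl, h'⟩ := List.cons.inj h
    simpa using hQ before d after h'

lemma ExecutableSeq.append {I : Finset V} {pre Q R : List (Command V)}
    (hQ : ExecutableSeq I pre Q) (hR : ExecutableSeq I (pre ++ Q) R) :
    ExecutableSeq I pre (Q ++ R) := by
  induction Q generalizing pre with
  | nil => simpa using hR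
  | cons c Q ih =>
    refine ExecutableSeq.cons (by simpa using hQ [] c Q rfl) (ih ?_ (by simpa using hR))
    intro before d after h
    simpa using hQ (c :: before) d after (by simp [h])

/-- Commands that neither measure nor prepare are executable if this holds for each of them. -/
lemma ExecutableSeq.of_forall_mem {I : Finset V} {pre Q : List (Command V)}
    (hm : ∀ c ∈ Q, ∀ v, ¬ c.Measures v) (h : ∀ c ∈ Q, Executable I pre c) :
    ExecutableSeq I pre Q := by
  rintro before c after rfl
  obtain ⟨h1, h2⟩ := h c (by simp)
  refine ⟨fun j hj => ?_, fun v hv hp => ⟨?_, ?_⟩⟩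
  · obtain ⟨d, hd, hd'⟩ := h1 j hj
    exact ⟨d, by simp [hd], hd'⟩
  · rintro ⟨d, hd, hd'⟩
    rcases List.mem_append.mp hd with hd | hd
    · exact (h2 v hv hp).1 ⟨d, hd, hd'⟩
    · exact hm d (by simp [hd]) v hd'
  · refine (h2 v hv hp).2.imp_right ?_
    rintro ⟨d, hd, hd'⟩
    exact ⟨d, by simp [hd], hd'⟩

end Stages

/-! ### Causal order and injectivity of the flow function -/

section Order

variable {V : Type*} [PartialOrder V]

lemma IsMeasurementOrder.nodup {O : Finset V} {l : List {v // v ∉ O}}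
    (hl : IsMeasurementOrder O l) : l.Nodup :=
  hl.2.imp fun h => by rintro rfl; exact h le_rfl

lemma IsMeasurementOrder.mem_of_le {O : Finset V} {l l₁ l₂ : List {v // v ∉ O}}
    (hl : IsMeasurementOrder O l) {i j : {v // v ∉ O}} (h : l = l₁ ++ i :: l₂)
    (hji : (j : V) ≤ i) (hne : (i : V) ≠ j) : j ∈ l₁ := by
  have hj := hl.1 j
  have hp := hl.2
  rw [h, List.mem_append, List.mem_cons] at hj
  rw [h, List.pairwise_append, List.pairwise_cons] at hp
  rcases hj with hj | rfl | hj
  · exact hj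
  · exact absurd rfl hne
  · exact absurd hji (hp.2.1.1 j hj)

/-- If `f x = f y` with `x ≠ y`, each of `x`, `y` is a neighbour of the other's image, so each
precedes the other. -/
lemma IsFlow.injective {G : SimpleGraph V} {I O : Finset V}
    {f : {v // v ∉ O} → {v // v ∉ I}} (hf : IsFlow G I O f) : Function.Injective f := by
  intro x y h
  by_contra hne
  have hne' : (x : V) ≠ y := fun h => hne (Subtype.ext h)
  exact hne' (le_antisymm (hf.le_of_adj x y hne'.symm (h ▸ hf.adj y))
    (hf.le_of_adj y x hne' (h ▸ hf.adj x)))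

end Order

section Compact

variable {V : Type*} [Fintype V] [DecidableEq V]

/-! ### The interleaved pattern -/

lemma IsMeasurementOrder.coe_eq_univ [PartialOrder V] {O : Finset V} {l : List {v // v ∉ O}}
    (hl : IsMeasurementOrder O l) :
    (l : Multiset {v // v ∉ O}) = (Finset.univ : Finset {v // v ∉ O}).val :=
  (Multiset.Nodup.ext (by simpa using hl.nodup) Finset.univ.nodup).mpr (by simp [hl.1])

lemma mem_laterNeighbours {G : SimpleGraph V} {O : Finset V} {l : List {v // v ∉ O}}
    {i : {v // v ∉ O}} {k : V} : k ∈ laterNeighbours G O l i ↔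
      G.Adj i k ∧ ∀ hk : k ∉ O, l.idxOf i < l.idxOf ⟨k, hk⟩ := by
  simp [laterNeighbours]

lemma mem_xSignal {I O : Finset V} {f : {v // v ∉ O} → {v // v ∉ I}} {i j : V} :
    j ∈ xSignal I O f i ↔ ∃ h : j ∉ O, (f ⟨j, h⟩ : V) = i := by
  simp [xSignal]

lemma mem_zSignal {G : SimpleGraph V} {I O : Finset V} {f : {v // v ∉ O} → {v // v ∉ I}}
    {i j : V} : j ∈ zSignal G I O f i ↔ ∃ h : j ∉ O, G.Adj (f ⟨j, h⟩) i ∧ i ≠ j := by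
  simp only [zSignal, Finset.mem_filter, Finset.mem_univ, true_and]
  exact ⟨fun ⟨h, k, hk, h'⟩ => ⟨h, hk ▸ h'⟩, fun ⟨h, h'⟩ => ⟨h, _, rfl, h'⟩⟩

variable (G : SimpleGraph V) (I O : Finset V)
  (f : {v // v ∉ O} → {v // v ∉ I}) (a : {v // v ∉ O} → ℝ) (l : List {v // v ∉ O})

lemma exists_measures_flatMap_compactStep (l₁ : List {v // v ∉ O}) (v : V) :
    (∃ d ∈ l₁.flatMap (compactStep G I O f a l), d.Measures v) ↔ ∃ h : v ∉ O, ⟨v, h⟩ ∈ l₁ := by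
  constructor
  · rintro ⟨d, hd, hv⟩
    obtain ⟨i, hi, hd⟩ := List.mem_flatMap.mp hd
    simp only [compactStep, List.mem_cons, List.mem_append, List.mem_map, List.not_mem_nil,
      or_false] at hd
    rcases hd with rfl | ⟨k, -, rfl⟩ | rfl
    · exact hv.elim
    · exact hv.elim
    · obtain rfl : v = i := hv
      exact ⟨i.2, hi⟩
  · rintro ⟨h, hv⟩
    exact ⟨meas v (a ⟨v, h⟩) (xSignal I O f v) (zSignal G I O f v),
      List.mem_flatMap.mpr ⟨_, hv, by simp [compactStep]⟩, rfl⟩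

lemma exists_prepares_flatMap_compactStep (l₁ : List {v // v ∉ O}) (v : V) :
    (∃ d ∈ l₁.flatMap (compactStep G I O f a l), d.Prepares v) ↔ ∃ i ∈ l₁, (f i : V) = v := by
  constructor
  · rintro ⟨d, hd, hv⟩
    obtain ⟨i, hi, hd⟩ := List.mem_flatMap.mp hd
    simp only [compactStep, List.mem_cons, List.mem_append, List.mem_map, List.not_mem_nil,
      or_false] at hd
    rcases hd with rfl | ⟨k, -, rfl⟩ | rfl
    · exact ⟨i, hi, Eq.symm hv⟩
    · exact hv.elim
    · exact hv.elim
  · rintro ⟨i, hi, rfl⟩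
    exact ⟨prep (f i) plus, List.mem_flatMap.mpr ⟨i, hi, by simp [compactStep]⟩, rfl⟩

variable {G I O f l}

/-- If `i` is `f j` or a neighbour of `f j`, the flow gives `j ≤ i`. So whatever step `i` entangles
has been prepared, and all outcomes in its signals are known. -/
lemma executableSeq_compactStep [PartialOrder V] (hf : IsFlow G I O f)
    (hsurj : Function.Surjective f) (hl : IsMeasurementOrder O l) {l₁ l₂ : List {v // v ∉ O}}
    {i : {v // v ∉ O}} (h : l = l₁ ++ i :: l₂) :
    ExecutableSeq I (l₁.flatMap (compactStep G I O f a l)) (compactStep G I O f a l i) := by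
  have hnd := hl.nodup
  rw [h] at hnd
  have hi : i ∉ l₁ := fun hi =>
    (List.disjoint_of_nodup_append hnd) hi (by simp)
  -- Surjectivity writes `v` as `f j`; then `j` is `i` or strictly precedes it, so `v` is prepared
  -- in an earlier step or at the start of this one.
  have hmem : ∀ v ∉ I, v = i ∨ G.Adj i v → ∃ j, (f j : V) = v ∧ (j ∈ l₁ ∨ j = i) := by
    intro v hv hiv
    obtain ⟨j, hj⟩ := hsurj ⟨v, hv⟩
    have hj' : (f j : V) = v := congrArg Subtype.val hj
    refine ⟨j, hj', ?_⟩
    by_cases hji : j = i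
    · exact Or.inr hji
    · have hne : (i : V) ≠ j := fun h => hji (Subtype.ext h.symm)
      refine Or.inl (hl.mem_of_le h ?_ hne)
      rcases hiv with rfl | hiv
      · exact hj' ▸ hf.le j
      · exact hf.le_of_adj j i hne (hj' ▸ hiv)
  have hprep : ∀ v : V, (v = i ∨ G.Adj i v) → v ∈ I ∨
      ∃ d ∈ l₁.flatMap (compactStep G I O f a l) ++ [prep (f i : V) plus], d.Prepares v := by
    intro v hv
    by_cases hvI : v ∈ I
    · exact Or.inl hvI
    · obtain ⟨j, rfl, hj | rfl⟩ := hmem v hvI hv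
      · obtain ⟨d, hd, hd'⟩ := (exists_prepares_flatMap_compactStep G I O f a l l₁ (f j)).mpr
          ⟨j, hj, rfl⟩
        exact Or.inr ⟨d, List.mem_append_left _ hd, hd'⟩
      · exact Or.inr ⟨prep (f j) plus, by simp, rfl⟩
  have hmeas : ∀ v : V, (v = i ∨ v ∈ laterNeighbours G O l i) →
      ¬ ∃ d ∈ l₁.flatMap (compactStep G I O f a l), d.Measures v := by
    intro v hv
    rw [exists_measures_flatMap_compactStep]
    rintro ⟨hvO, hvl⟩
    rcases hv with rfl | hv
    · exact hi hvl
    · have h1 := (mem_laterNeighbours.mp hv).2 hvO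
      rw [h, List.idxOf_append_of_mem hvl, List.idxOf_append_of_notMem hi] at h1
      have h2 := List.idxOf_lt_length_of_mem hvl
      omega
  have hdep : ∀ j, j ∈ xSignal I O f i ∨ j ∈ zSignal G I O f i →
      ∃ d ∈ l₁.flatMap (compactStep G I O f a l), d.Measures j := by
    intro j hj
    rw [exists_measures_flatMap_compactStep]
    rcases hj with hj | hj
    · obtain ⟨hjO, hj⟩ := mem_xSignal.mp hj
      have hlt := hf.lt ⟨j, hjO⟩
      rw [hj] at hlt
      exact ⟨hjO, hl.mem_of_le h hlt.le hlt.ne'⟩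
    · obtain ⟨hjO, hj, hne⟩ := mem_zSignal.mp hj
      exact ⟨hjO, hl.mem_of_le h (hf.le_of_adj ⟨j, hjO⟩ i hne hj.symm) hne⟩
  refine ExecutableSeq.cons ⟨fun j hj => hj.elim, fun v hv hp => absurd hv hp⟩
    (ExecutableSeq.append (ExecutableSeq.of_forall_mem ?_ ?_) (ExecutableSeq.cons ⟨?_, ?_⟩
      (ExecutableSeq.nil _ _)))
  · intro c hc v hv
    obtain ⟨k, -, rfl⟩ := List.mem_map.mp hc
    exact hv
  · intro c hc
    obtain ⟨k, hk, rfl⟩ := List.mem_map.mp hc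
    rw [Finset.mem_toList] at hk
    refine ⟨fun j hj => hj.elim, fun v hv _ => ?_⟩
    have hv' : v = (i : V) ∨ v = k := by simpa [ActsOn] using hv
    refine ⟨?_, hprep v (hv'.imp_right fun hvk : v = k => hvk ▸ (mem_laterNeighbours.mp hk).1)⟩
    rintro ⟨d, hd, hd'⟩
    rcases List.mem_append.mp hd with hd | hd
    · exact hmeas v (hv'.imp_right fun hvk : v = k => hvk ▸ hk) ⟨d, hd, hd'⟩
    · obtain rfl := List.mem_singleton.mp hd
      exact hd'
  · intro j hj
    obtain ⟨d, hd, hd'⟩ := hdep j hj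
    exact ⟨d, by simp [hd], hd'⟩
  · intro v hv _
    have hv' : v = i := hv
    constructor
    · rintro ⟨d, hd, hd'⟩
      rcases List.mem_append.mp hd with hd | hd
      · rcases List.mem_append.mp hd with hd | hd
        · exact hmeas v (Or.inl hv') ⟨d, hd, hd'⟩
        · obtain rfl := List.mem_singleton.mp hd
          exact hd'
      · obtain ⟨k, -, rfl⟩ := List.mem_map.mp hd
        exact hd'
    · refine (hprep v (Or.inl hv')).imp_right ?_
      rintro ⟨d, hd, hd'⟩
      exact ⟨d, List.mem_append_left _ hd, hd'⟩

lemma executableSeq_flatMap_compactStep [PartialOrder V] (hf : IsFlow G I O f)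
    (hsurj : Function.Surjective f) (hl : IsMeasurementOrder O l) (l₂ : List {v // v ∉ O}) :
    ∀ l₁, l = l₁ ++ l₂ → ExecutableSeq I (l₁.flatMap (compactStep G I O f a l))
      (l₂.flatMap (compactStep G I O f a l)) := by
  induction l₂ with
  | nil => exact fun _ _ => ExecutableSeq.nil _ _
  | cons i l₂ ih =>
    intro l₁ h
    rw [List.flatMap_cons]
    refine ExecutableSeq.append (executableSeq_compactStep a hf hsurj hl h) ?_
    have := ih (l₁ ++ [i]) (by simp [h])
    simpa using this

/-- The commands of the last stage of the interleaved pattern. -/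
lemma mem_compactPattern_tail [DecidableRel G.Adj] {c : Command V}
    (hc : c ∈ (G.edgeFinset.filter fun e => ∀ v ∈ e, v ∈ O).toList.map ent ++
      O.toList.flatMap fun i => [corrZ i (zSignal G I O f i), corrX i (xSignal I O f i)]) :
    (∀ v, ¬ c.Measures v) ∧ (∀ v, ¬ c.Prepares v) ∧ (∀ v, c.ActsOn v → v ∈ O) ∧
      ∀ j, c.DependsOn j → j ∉ O := by
  rcases List.mem_append.mp hc with hc | hc
  · obtain ⟨e, he, rfl⟩ := List.mem_map.mp hc
    rw [Finset.mem_toList, Finset.mem_filter] at he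
    exact ⟨fun _ => id, fun _ => id, fun v hv => he.2 v hv, fun _ hj => hj.elim⟩
  · obtain ⟨i, hi, hc⟩ := List.mem_flatMap.mp hc
    rw [Finset.mem_toList] at hi
    simp only [List.mem_cons, List.not_mem_nil, or_false] at hc
    rcases hc with rfl | rfl
    · exact ⟨fun _ => id, fun _ => id, fun v hv => (show v = i from hv) ▸ hi,
        fun j hj => (mem_zSignal.mp hj).1⟩
    · exact ⟨fun _ => id, fun _ => id, fun v hv => (show v = i from hv) ▸ hi,
        fun j hj => (mem_xSignal.mp hj).1⟩

/-- The final stage touches only outputs, which are never measured, and by then surjectivity of `f`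
has had every non-input prepared. -/
theorem runnable_compactPattern [PartialOrder V] [DecidableRel G.Adj] (hf : IsFlow G I O f)
    (hsurj : Function.Surjective f) (hl : IsMeasurementOrder O l) :
    Runnable I O (compactPattern G I O f a l) := by
  classical
  have hM : ∀ v, (∃ d ∈ l.flatMap (compactStep G I O f a l), d.Measures v) ↔ v ∉ O := fun v => by
    rw [exists_measures_flatMap_compactStep]
    exact ⟨fun h => h.1, fun h => ⟨h, hl.1 _⟩⟩
  have hN : ∀ v, (∃ d ∈ l.flatMap (compactStep G I O f a l), d.Prepares v) ↔ v ∉ I := fun v => by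
    rw [exists_prepares_flatMap_compactStep]
    constructor
    · rintro ⟨i, -, rfl⟩
      exact (f i).2
    · intro h
      obtain ⟨i, hi⟩ := hsurj ⟨v, h⟩
      exact ⟨i, hl.1 i, congrArg Subtype.val hi⟩
  have hex : ExecutableSeq I [] (compactPattern G I O f a l) := by
    refine ExecutableSeq.append (executableSeq_flatMap_compactStep a hf hsurj hl l [] rfl)
      (ExecutableSeq.of_forall_mem (fun c hc => (mem_compactPattern_tail hc).1) fun c hc => ?_)
    obtain ⟨-, -, h3, h4⟩ := mem_compactPattern_tail hc
    refine ⟨fun j hj => (hM j).mpr (h4 j hj), fun v hv _ => ⟨fun h => (hM v).mp h (h3 v hv), ?_⟩⟩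
    by_cases hvI : v ∈ I
    · exact Or.inl hvI
    · exact Or.inr ((hN v).mpr hvI)
  refine ⟨fun b c e h => (hex b c e h).1, fun b c e h => (hex b c e h).2, fun v => ?_, fun v => ?_⟩
  · rw [← hM]
    constructor
    · rintro ⟨c, hc, hv⟩
      rcases List.mem_append.mp hc with hc | hc
      · exact ⟨c, hc, hv⟩
      · exact ((mem_compactPattern_tail hc).1 v hv).elim
    · rintro ⟨c, hc, hv⟩
      exact ⟨c, List.mem_append_left _ hc, hv⟩
  · rw [← hN]
    constructor
    · rintro ⟨c, hc, hv⟩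
      rcases List.mem_append.mp hc with hc | hc
      · exact ⟨c, hc, hv⟩
      · exact ((mem_compactPattern_tail hc).2.1 v hv).elim
    · rintro ⟨c, hc, hv⟩
      exact ⟨c, List.mem_append_left _ hc, hv⟩

lemma filterMap_compactPattern [DecidableRel G.Adj] {β : Type*} (g : Command V → Option β) :
    (compactPattern G I O f a l).filterMap g =
      (l.flatMap fun i => (compactStep G I O f a l i).filterMap g) ++
        (((G.edgeFinset.filter fun e => ∀ v ∈ e, v ∈ O).toList.map ent).filterMap g ++
          O.toList.flatMap fun i =>
            [corrZ i (zSignal G I O f i), corrX i (xSignal I O f i)].filterMap g) := by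
  classical
  simp only [compactPattern, List.filterMap_append, List.filterMap_flatMap]

/-- Signals enter only through the measurements of non-outputs and the final corrections of outputs,
so each qubit is corrected in one place. -/
lemma sum_map_compactPattern [PartialOrder V] [DecidableRel G.Adj] (hl : IsMeasurementOrder O l)
    (g : Command V → ZMod 2) (hprep : ∀ v q, g (prep v q) = 0) (hent : ∀ e, g (ent e) = 0) :
    ((compactPattern G I O f a l).map g).sum =
      ∑ i : {v // v ∉ O}, g (meas (i : V) (a i) (xSignal I O f i) (zSignal G I O f i)) +
        ∑ i ∈ O, (g (corrZ i (zSignal G I O f i)) + g (corrX i (xSignal I O f i))) := by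
  have hents : ∀ L : List (Sym2 V), ((L.map ent).map g).sum = 0 := fun L => by
    simp [List.sum_eq_zero, hent]
  have hfm : ∀ {α : Type _} (L : List α) (h : α → List (Command V)),
      ((L.flatMap h).map g).sum = (L.map fun i => ((h i).map g).sum).sum := fun L h => by
    induction L with
    | nil => simp
    | cons x L ih => simp [ih]
  have hstep : ∀ i, ((compactStep G I O f a l i).map g).sum =
      g (meas (i : V) (a i) (xSignal I O f i) (zSignal G I O f i)) := fun i => by
    have : (((laterNeighbours G O l i).toList.map fun k => ent s((i : V), k)).map g).sum = 0 := by
      simp [List.sum_eq_zero, hent]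
    simp only [compactStep, List.map_cons, List.sum_cons, hprep, List.map_append, List.sum_append]
    rw [this]; simp
  simp only [compactPattern, List.map_append, List.sum_append]
  rw [hents, hfm, hfm, zero_add]
  simp only [hstep]
  congr 1
  · rw [← Multiset.sum_coe, ← Multiset.map_coe, hl.coe_eq_univ]; rfl
  · simp [Finset.sum_map_toList]

theorem isFlowPattern_compactPattern [PartialOrder V] [DecidableRel G.Adj] (hf : IsFlow G I O f)
    (hsurj : Function.Surjective f) (hl : IsMeasurementOrder O l) :
    IsFlowPattern G I O f a (compactPattern G I O f a l) := by
  classical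
  refine ⟨?_, ?_, ?_, ?_, fun w j => ?_, fun w j => ?_⟩
  · have : (compactPattern G I O f a l).filterMap prepData =
        l.map fun i : {v // v ∉ O} => ((f i : V), plus) := by
      rw [filterMap_compactPattern, List.map_eq_flatMap (l := l)]
      simp [compactStep, prepData, List.filterMap_cons, List.filterMap_map, Function.comp_def]
    rw [this, ← Multiset.map_coe, hl.coe_eq_univ]
    -- Bijectivity of `f`: the preparations run through the non-inputs exactly once.
    have h2 : (Finset.univ : Finset {v // v ∉ O}).val.map (fun i => (f i : V)) = (Iᶜ).val := by
      refine (Multiset.Nodup.ext (Finset.univ.nodup.map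
        (Subtype.val_injective.comp hf.injective)) (Iᶜ).nodup).mpr fun v => ?_
      simp only [Multiset.mem_map, Finset.mem_val, Finset.mem_univ, true_and, Finset.mem_compl]
      constructor
      · rintro ⟨i, rfl⟩
        exact (f i).2
      · intro h
        obtain ⟨i, hi⟩ := hsurj ⟨v, h⟩
        exact ⟨i, congrArg Subtype.val hi⟩
    rw [← h2, Multiset.map_map]; rfl
  · have : (compactPattern G I O f a l).filterMap entData =
        (l.flatMap fun i => (laterNeighbours G O l i).toList.map fun k => s((i : V), k)) ++
          (G.edgeFinset.filter fun e => ∀ v ∈ e, v ∈ O).toList := by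
      rw [filterMap_compactPattern]
      simp [compactStep, entData, List.filterMap_cons, List.filterMap_map, Function.comp_def]
    rw [this]
    refine (Multiset.Nodup.ext ?_ G.edgeFinset.nodup).mpr fun e => ?_
    · rw [Multiset.coe_nodup, List.nodup_append']
      refine ⟨?_, Finset.nodup_toList _, ?_⟩
      · rw [List.nodup_flatMap]
        refine ⟨fun i _ => ?_, hl.nodup.imp fun {i j} hij => ?_⟩
        · refine (Finset.nodup_toList _).map fun k k' h => ?_
          exact Sym2.congr_right.mp h
        · intro e he he'
          simp only [List.mem_map, Finset.mem_toList, mem_laterNeighbours] at he he'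
          obtain ⟨k, ⟨-, hk⟩, rfl⟩ := he
          obtain ⟨k', ⟨-, hk'⟩, he⟩ := he'
          -- An edge occurring in two different steps would have each endpoint measured before the
          -- other.
          rcases Sym2.eq_iff.mp he with ⟨h, -⟩ | ⟨rfl, rfl⟩
          · exact hij (Subtype.ext h.symm)
          · exact lt_asymm (hk j.2) (hk' i.2)
      · intro e he he'
        simp only [List.mem_flatMap, List.mem_map, Finset.mem_toList, Finset.mem_filter] at he he'
        obtain ⟨i, -, k, -, rfl⟩ := he
        exact i.2 (he'.2 i (by simp))
    · simp only [Multiset.mem_coe, List.mem_append, List.mem_flatMap, List.mem_map,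
        Finset.mem_toList, Finset.mem_filter, Finset.mem_val, mem_laterNeighbours]
      constructor
      · rintro (⟨i, -, k, ⟨h, -⟩, rfl⟩ | h)
        · simpa using h
        · exact h.1
      · induction e with
        | _ u v =>
          intro he
          have huv : G.Adj u v := by simpa using he
          -- The edge belongs to the step of its endpoint measured first, or to the last stage if
          -- neither endpoint is measured.
          by_cases hu : u ∈ O
          · by_cases hv : v ∈ O
            · exact Or.inr ⟨he, by simp [hu, hv]⟩
            · exact Or.inl ⟨⟨v, hv⟩, hl.1 _, u, ⟨huv.symm, fun h => absurd hu h⟩, Sym2.eq_swap⟩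
          · by_cases hv : v ∈ O
            · exact Or.inl ⟨⟨u, hu⟩, hl.1 _, v, ⟨huv, fun h => absurd hv h⟩, rfl⟩
            · have hne : l.idxOf ⟨u, hu⟩ ≠ l.idxOf ⟨v, hv⟩ := fun h => huv.ne
                (congrArg Subtype.val ((List.idxOf_inj (hl.1 _)).mp h))
              rcases lt_or_gt_of_ne hne with h | h
              · exact Or.inl ⟨⟨u, hu⟩, hl.1 _, v, ⟨huv, fun _ => h⟩, rfl⟩
              · exact Or.inl ⟨⟨v, hv⟩, hl.1 _, u, ⟨huv.symm, fun _ => h⟩, Sym2.eq_swap⟩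
  · have : (compactPattern G I O f a l).filterMap measData =
        l.map fun i : {v // v ∉ O} => ((i : V), a i) := by
      rw [filterMap_compactPattern, List.map_eq_flatMap (l := l)]
      simp [compactStep, measData, List.filterMap_cons, List.filterMap_map, Function.comp_def]
    rw [this, ← Multiset.map_coe, hl.coe_eq_univ]
  · rw [compactPattern, ← List.append_assoc, List.pairwise_append]
    have h1 : ∀ c ∈ l.flatMap (compactStep G I O f a l) ++
        (G.edgeFinset.filter fun e => ∀ v ∈ e, v ∈ O).toList.map ent, ∀ v, ¬ c.Corrects v := by
      intro c hc v hv
      simp only [List.mem_append, List.mem_flatMap, compactStep, List.mem_cons, List.mem_map,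
        List.not_mem_nil, or_false] at hc
      rcases hc with ⟨i, -, rfl | ⟨k, -, rfl⟩ | rfl⟩ | ⟨e, -, rfl⟩ <;> exact hv
    have h2 : ∀ d ∈ O.toList.flatMap (fun i =>
        [corrZ i (zSignal G I O f i), corrX i (xSignal I O f i)]), ∀ e, d ≠ ent e := by
      rintro d hd e rfl
      simp at hd
    refine ⟨List.pairwise_of_forall_mem_list fun c hc d _ v e hv => (h1 c hc v hv).elim,
      List.pairwise_of_forall_mem_list fun c _ d hd v e _ he => (h2 d hd e he).elim,
      fun c hc d _ v e hv => (h1 c hc v hv).elim⟩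
  · rw [sum_map_compactPattern a hl (xDep w j) (fun _ _ => rfl) (fun _ => rfl)]
    simp only [xDep, zero_add, ← mem_xSignal (f := f)]
    by_cases hw : w ∈ O
    · rw [Finset.sum_eq_zero, Finset.sum_eq_single w, zero_add]
      · simp
      · intro i _ hi; simp [hi.symm]
      · exact fun h => absurd hw h
      · intro i _
        have : w ≠ i := fun h => i.2 (h ▸ hw)
        simp [this]
    · rw [Finset.sum_eq_single ⟨w, hw⟩, Finset.sum_eq_zero (s := O), add_zero]
      · simp
      · intro i hi
        have : w ≠ i := fun h => hw (h ▸ hi)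
        simp [this]
      · intro i _ hi
        have : w ≠ i := fun h => hi (Subtype.ext h.symm)
        simp [this]
      · simp
  · rw [sum_map_compactPattern a hl (zDep w j) (fun _ _ => rfl) (fun _ => rfl)]
    simp only [zDep, add_zero, ← mem_zSignal (f := f)]
    by_cases hw : w ∈ O
    · rw [Finset.sum_eq_zero, Finset.sum_eq_single w, zero_add]
      · simp
      · intro i _ hi; simp [hi.symm]
      · exact fun h => absurd hw h
      · intro i _
        have : w ≠ i := fun h => i.2 (h ▸ hw)
        simp [this]
    · rw [Finset.sum_eq_single ⟨w, hw⟩, Finset.sum_eq_zero (s := O), add_zero]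
      · simp
      · intro i hi
        have : w ≠ i := fun h => hw (h ▸ hi)
        simp [this]
      · intro i _ hi
        have : w ≠ i := fun h => hi (Subtype.ext h.symm)
        simp [this]
      · simp

end Compact

/-! ### Counting inputs and outputs -/

lemma IsFlow.bijective {V : Type*} [Fintype V] [DecidableEq V] [PartialOrder V] {G : SimpleGraph V}
    {I O : Finset V} {f : {v // v ∉ O} → {v // v ∉ I}} (hf : IsFlow G I O f)
    (hcard : I.card = O.card ∨ Function.Surjective f) : Function.Bijective f := by
  refine ⟨hf.injective, hcard.elim (fun h => ?_) id⟩
  refine (Fintype.bijective_iff_injective_and_card f).mpr ⟨hf.injective, ?_⟩ |>.2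
  simp [Fintype.card_subtype_compl, h]

lemma IsFlow.card_eq {V : Type*} [Fintype V] [DecidableEq V] [PartialOrder V]
    {G : SimpleGraph V} {I O : Finset V} {f : {v // v ∉ O} → {v // v ∉ I}} (hf : IsFlow G I O f)
    (hcard : I.card = O.card ∨ Function.Surjective f) : I.card = O.card := by
  have h := Fintype.card_of_bijective (hf.bijective hcard)
  simp only [Fintype.card_subtype_compl, Fintype.card_coe] at h
  -- The complements have truncated differences as cardinalities; these bounds allow cancellation.
  have hI := I.card_le_univ
  have hO := O.card_le_univ
  omega

section Main

variable {V : Type*} [Fintype V] [DecidableEq V] [PartialOrder V] {G : SimpleGraph V}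
  [DecidableRel G.Adj] {I O : Finset V} {f : {v // v ∉ O} → {v // v ∉ I}}
  {a : {v // v ∉ O} → ℝ} {P Q : List (Command V)}

/-! ### Equivalence and determinism of runnable flow patterns -/

/-- Both branches are unit multiples of the same scaled operator, so their ratio is a phase. -/
theorem IsFlowPattern.equivalent (hf : IsFlow G I O f) (hP : IsFlowPattern G I O f a P)
    (hPR : Runnable I O P) (hQ : IsFlowPattern G I O f a Q) (hQR : Runnable I O Q) :
    Equivalent I O P Q := by
  intro s
  obtain ⟨γ, hγ, h⟩ := exists_branch_eq hf hP hPR s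
  obtain ⟨δ, hδ, h'⟩ := exists_branch_eq hf hQ hQR s
  have hδ0 : δ ≠ 0 := fun h0 => by simp [h0] at hδ
  refine ⟨γ / δ, by rw [norm_div, hγ, hδ, div_one], ?_⟩
  rw [h, h', smul_smul]
  congr 1
  field_simp

/-- The phases cancel in the conjugation, and the `2 ^ |Oᶜ|` branches contribute the fraction `2 ^
(-|Oᶜ|)` each. -/
theorem IsFlowPattern.implements (hf : IsFlow G I O f) (hP : IsFlowPattern G I O f a P)
    (hPR : Runnable I O P) : Implements I O P (flowUnitary G I O a) := by
  refine ⟨exists_branch_eq hf hP hPR, fun ρ => ?_⟩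
  have hc : Fintype.card ({v // v ∉ O} → ZMod 2) = 2 ^ (Oᶜ).card := by
    rw [Fintype.card_fun, ZMod.card, Fintype.card_subtype_compl]
    simp [Finset.card_compl]
  have hterm : ∀ s, branch I O P s * ρ * (branch I O P s)ᴴ =
      ((2 : ℂ) ^ (Oᶜ).card)⁻¹ • (flowUnitary G I O a * ρ * (flowUnitary G I O a)ᴴ) := by
    intro s
    obtain ⟨γ, hγ, h⟩ := exists_branch_eq hf hP hPR s
    rw [h, Matrix.conjTranspose_smul, Matrix.smul_mul, Matrix.smul_mul, Matrix.mul_smul, smul_smul]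
    congr 1
    have hγγ : γ * conj γ = 1 := by rw [Complex.mul_conj, Complex.normSq_eq_norm_sq, hγ]; simp
    rw [Complex.star_def, map_div₀, map_pow, Complex.conj_ofReal, div_mul_div_comm, hγγ, ← mul_pow,
      sqrt_two_mul_self, one_div]
  simp only [hterm]
  rw [Finset.sum_const, Finset.card_univ, hc, ← Nat.cast_smul_eq_nsmul ℂ, smul_smul]
  push_cast
  rw [mul_inv_cancel₀ (pow_ne_zero _ two_ne_zero), one_smul]

end Main

end MBQC

theorem mainTheorem3 {V : Type*} [Fintype V] [DecidableEq V] [PartialOrder V]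
    (G : SimpleGraph V) [DecidableRel G.Adj] (I O : Finset V)
    (f : {v // v ∉ O} → {v // v ∉ I}) (hf : MBQC.IsFlow G I O f)
    (hcard : I.card = O.card ∨ Function.Surjective f)
    (a : {v // v ∉ O} → ℝ)
    (l : List {v // v ∉ O}) (hl : MBQC.IsMeasurementOrder O l) :
    MBQC.Runnable I O (MBQC.compactPattern G I O f a l) ∧
    MBQC.IsFlowPattern G I O f a (MBQC.compactPattern G I O f a l) ∧
    (∀ P : List (MBQC.Command V), MBQC.IsFlowPattern G I O f a P → MBQC.Runnable I O P →
      MBQC.Equivalent I O P (MBQC.compactPattern G I O f a l)) ∧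
    ((MBQC.flowUnitary G I O a)ᴴ * MBQC.flowUnitary G I O a = 1 ∧
      MBQC.flowUnitary G I O a * (MBQC.flowUnitary G I O a)ᴴ = 1) ∧
    MBQC.Implements I O (MBQC.compactPattern G I O f a l) (MBQC.flowUnitary G I O a) := by
  have hsurj := (hf.bijective hcard).2
  have hR := MBQC.runnable_compactPattern a hf hsurj hl
  have hF := MBQC.isFlowPattern_compactPattern a hf hsurj hl
  exact ⟨hR, hF, fun P hP hPR => hP.equivalent hf hPR hF hR,
    ⟨MBQC.conjTranspose_flowUnitary_mul_self hf a,
      MBQC.flowUnitary_mul_conjTranspose hf (hf.card_eq hcard) a⟩, hF.implements hf hR⟩
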